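/- There is an absolute constant $C>0$ with the following property. Let $n\ge 1$, let $t_n\in\mathbb R$, and let $\xi_1,\dots,\xi_n$ be independent real random variables with $E\xi_i=0$ and $E e^{t_n|\xi_i|}<\infty$ for $1\le i\le n$, and with $\sum_{i=1}^n E\xi_i^2=1$. Let $W=\sum_{i=1}^n\xi_i$, let $\Phi$ be the standard normal distribution function, and for $0\le x\le t_n$ let $$\gamma=\gamma(x)=\sum_{i=1}^n E\bigl(|\xi_i|^3e^{x|\xi_i|}\bigr)\in[0,\infty].$$ Then for every $0\le x\le t_n$ with $\gamma(x)<\infty$ (which holds for every $0\le x<t_n$), $$\left|\frac{P(W\ge x)}{1-\Phi(x)}-1\right|\le C\,(1+x^3)\,\gamma\, e^{4x^3\gamma}.$$ If $\gamma(t_n)=\infty$, the bound at $x=t_n$ has an infinite right-hand side and asserts nothing. -/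

import Mathlib

open MeasureTheory ProbabilityTheory
open scoped ENNReal

/-- The quantity `γ(x) = ∑ i, E (|ξ i|³ exp (x |ξ i|))`, as an element of `[0, ∞]`
(it can be infinite at the right end point of the range of `x`). -/
noncomputable def cramerGamma {Ω : Type*} [MeasurableSpace Ω] (μ : Measure Ω) {n : ℕ}
    (ξ : Fin n → Ω → ℝ) (x : ℝ) : ℝ≥0∞ :=
  ∑ i, ∫⁻ ω, ENNReal.ofReal (|ξ i ω| ^ 3 * Real.exp (x * |ξ i ω|)) ∂μ

/-- The standard normal distribution function `Φ`. -/
noncomputable def stdNormalCdf (x : ℝ) : ℝ := cdf (gaussianReal 0 1) x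

/-! The proof is Cramér's change of measure. Under the law with density `exp (x W) / E exp (x W)`
the summands stay independent (`map_tilted_mul_sum`). The mean of `W` becomes `x` up to `O(x² γ)`,
its variance stays `1` up to `O(x γ)`, and the third absolute central moments of the summands add up
to `O(γ)` (`tilted_moment_bounds`). So `x` has moved to the centre of the law, and a Berry–Esseen
bound shows that `W - x` is standard normal with uniform error `ε = O((1 + x²) γ)`
(`abs_tilted_sum_lt_sub_stdNormalCdf_le`).

Undoing the tilt gives `P(W ≥ x) = E exp (x W) · exp (-x²) · I`, where `I` is the tilted mean of
`exp (-x (W - x))` on `W ≥ x`. For a standard normal variable in place of `W - x`, this mean is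
exactly `exp (x²/2) (1 - Φ(x))`. The integrand lies in `[0, 1]` and its superlevel sets are
intervals, so the replacement costs at most `2 ε` (`abs_integral_expTail_sub_le`). The generating
function is `exp (x²/2)` times a factor between `exp (-2 x³ γ)` and `exp (x³ γ)`
(`integral_exp_mul_bounds`). Dividing by the normal tail costs a factor `O(1 + x)` by Mills' ratio,
and `(1 + x)(1 + x²)` is of order `1 + x³`.

Berry–Esseen itself is proved by Stein's method. The solution of Stein's equation has a derivative
that jumps at `z`; the probability that a leave-one-out sum falls near the jump is bounded by the
concentration inequality `measureReal_sum_mem_Icc_le`.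

No smallness of `γ` is assumed. With `G³ = E |ξ|³ exp (x |ξ|)` for one summand, Lyapunov's
inequality gives `E ξ² ≤ G²`, and the moment estimates then hold both for `x G ≥ 1`, where trivial
bounds suffice, and for `x G ≤ 1`, where Taylor expansion works. -/

/-! ### The standard normal law and Mills' ratio. -/

/-- The standard normal density. -/
noncomputable def stdNormalPdf (x : ℝ) : ℝ := gaussianPDFReal 0 1 x

theorem stdNormalPdf_eq (x : ℝ) :
    stdNormalPdf x = (√(2 * Real.pi))⁻¹ * Real.exp (-x ^ 2 / 2) := by
  simp [stdNormalPdf, gaussianPDFReal]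

theorem stdNormalPdf_pos (x : ℝ) : 0 < stdNormalPdf x :=
  gaussianPDFReal_pos _ _ _ one_ne_zero

theorem stdNormalPdf_neg (x : ℝ) : stdNormalPdf (-x) = stdNormalPdf x := by
  simp [stdNormalPdf_eq]

theorem continuous_stdNormalPdf : Continuous stdNormalPdf := by
  have : stdNormalPdf = fun x => (√(2 * Real.pi))⁻¹ * Real.exp (-x ^ 2 / 2) :=
    funext stdNormalPdf_eq
  rw [this]; fun_prop

theorem integrable_stdNormalPdf : Integrable stdNormalPdf := integrable_gaussianPDFReal 0 1

theorem hasDerivAt_stdNormalPdf (x : ℝ) : HasDerivAt stdNormalPdf (-x * stdNormalPdf x) x := by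
  have : stdNormalPdf = fun x => (√(2 * Real.pi))⁻¹ * Real.exp (-x ^ 2 / 2) :=
    funext stdNormalPdf_eq
  rw [this]
  have h : HasDerivAt (fun x : ℝ => -x ^ 2 / 2) (-x) x := by
    have := ((hasDerivAt_pow 2 x).fun_neg).div_const 2
    refine this.congr_deriv ?_
    push_cast; ring
  refine ((h.exp).const_mul ((√(2 * Real.pi))⁻¹)).congr_deriv ?_
  ring

theorem gaussianReal_real_eq (s : Set ℝ) :
    (gaussianReal 0 1).real s = ∫ u in s, stdNormalPdf u := by
  rw [measureReal_def, gaussianReal_apply_eq_integral 0 one_ne_zero, ENNReal.toReal_ofReal]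
  · rfl
  · exact integral_nonneg fun u => gaussianPDFReal_nonneg _ _ _

theorem stdNormalCdf_eq_integral (x : ℝ) :
    stdNormalCdf x = ∫ u in Set.Iic x, stdNormalPdf u := by
  rw [stdNormalCdf, cdf_eq_real, gaussianReal_real_eq]

theorem one_sub_stdNormalCdf (x : ℝ) :
    1 - stdNormalCdf x = ∫ u in Set.Ioi x, stdNormalPdf u := by
  have h := integral_add_compl (measurableSet_Iic (a := x)) integrable_stdNormalPdf
  have h1 : ∫ u, stdNormalPdf u = 1 := integral_gaussianPDFReal_eq_one 0 one_ne_zero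
  rw [Set.compl_Iic] at h
  rw [stdNormalCdf_eq_integral]; linarith

theorem stdNormalCdf_neg (x : ℝ) : stdNormalCdf (-x) = 1 - stdNormalCdf x := by
  rw [stdNormalCdf_eq_integral, one_sub_stdNormalCdf]
  have := integral_comp_neg_Ioi x stdNormalPdf
  rw [← this]
  simp [stdNormalPdf_neg]

theorem stdNormalCdf_nonneg (x : ℝ) : 0 ≤ stdNormalCdf x := cdf_nonneg _ _

theorem stdNormalCdf_le_one (x : ℝ) : stdNormalCdf x ≤ 1 := cdf_le_one _ _

theorem monotone_stdNormalCdf : Monotone stdNormalCdf := monotone_cdf _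

theorem hasDerivAt_stdNormalCdf (x : ℝ) : HasDerivAt stdNormalCdf (stdNormalPdf x) x := by
  have h : stdNormalCdf = fun y => stdNormalCdf 0 + ∫ u in (0 : ℝ)..y, stdNormalPdf u := by
    funext y
    rw [← intervalIntegral.integral_Iic_sub_Iic integrable_stdNormalPdf.integrableOn
      integrable_stdNormalPdf.integrableOn, stdNormalCdf_eq_integral, stdNormalCdf_eq_integral]
    ring
  rw [h]
  exact (intervalIntegral.integral_hasDerivAt_right
    (integrable_stdNormalPdf.intervalIntegrable)
    (continuous_stdNormalPdf.stronglyMeasurableAtFilter _ _)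
    continuous_stdNormalPdf.continuousAt).const_add _

theorem continuous_stdNormalCdf : Continuous stdNormalCdf :=
  continuous_iff_continuousAt.2 fun x => (hasDerivAt_stdNormalCdf x).continuousAt

theorem integral_Ioi_mul_stdNormalPdf (w : ℝ) :
    IntegrableOn (fun u => u * stdNormalPdf u) (Set.Ioi w) ∧
      ∫ u in Set.Ioi w, u * stdNormalPdf u = stdNormalPdf w := by
  have hint : Integrable (fun u => u * stdNormalPdf u) := by
    have := (integrable_mul_exp_neg_mul_sq (b := 1 / 2) (by norm_num)).const_mul
      ((√(2 * Real.pi))⁻¹)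
    refine this.congr (ae_of_all _ fun u => ?_)
    simp only [stdNormalPdf_eq]
    rw [show -(1 / 2) * u ^ 2 = -u ^ 2 / 2 by ring]; ring
  refine ⟨hint.integrableOn, ?_⟩
  have hlim : Filter.Tendsto (fun u => -stdNormalPdf u) Filter.atTop (nhds 0) := by
    rw [← neg_zero]
    refine Filter.Tendsto.neg ?_
    have : stdNormalPdf = fun x => (√(2 * Real.pi))⁻¹ * Real.exp (-x ^ 2 / 2) :=
      funext stdNormalPdf_eq
    rw [this, ← mul_zero (√(2 * Real.pi))⁻¹]
    refine Filter.Tendsto.const_mul _ (Real.tendsto_exp_atBot.comp ?_)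
    have h2 : Filter.Tendsto (fun x : ℝ => x ^ 2 / 2) Filter.atTop Filter.atTop :=
      (Filter.tendsto_pow_atTop two_ne_zero).atTop_div_const (by norm_num)
    refine (Filter.tendsto_neg_atTop_atBot.comp h2).congr fun u => ?_
    simp [neg_div]
  have hd : ∀ u ∈ Set.Ici w, HasDerivAt (fun u => -stdNormalPdf u) (u * stdNormalPdf u) u := by
    intro u _
    exact (hasDerivAt_stdNormalPdf u).fun_neg.congr_deriv (by ring)
  rw [integral_Ioi_of_hasDerivAt_of_tendsto' hd hint.integrableOn hlim]
  ring

/-- On the tail `u > w`, so `w φ(u) ≤ u φ(u) = -φ'(u)`; integrate. No sign of `w` is needed. -/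
theorem mul_one_sub_stdNormalCdf_le (w : ℝ) : w * (1 - stdNormalCdf w) ≤ stdNormalPdf w := by
  obtain ⟨hi, he⟩ := integral_Ioi_mul_stdNormalPdf w
  rw [one_sub_stdNormalCdf, ← he, ← integral_const_mul]
  refine setIntegral_mono_on (integrable_stdNormalPdf.integrableOn.const_mul _) hi
    measurableSet_Ioi fun u hu => ?_
  exact mul_le_mul_of_nonneg_right (le_of_lt hu) (stdNormalPdf_pos u).le

theorem one_fifth_le_stdNormalPdf {w : ℝ} (h0 : 0 ≤ w) (h1 : w ≤ 1) : 1 / 5 ≤ stdNormalPdf w := by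
  rw [stdNormalPdf_eq]
  have hs : √(2 * Real.pi) ≤ 13 / 5 := by
    rw [Real.sqrt_le_left (by norm_num)]
    nlinarith [Real.pi_lt_d2]
  have hs0 : 0 < √(2 * Real.pi) := by positivity
  have he : 9 / 16 ≤ Real.exp (-w ^ 2 / 2) := by
    have h2 := Real.add_one_le_exp (-w ^ 2 / 4)
    have h3 : Real.exp (-w ^ 2 / 2) = Real.exp (-w ^ 2 / 4) ^ 2 := by
      rw [← Real.exp_nat_mul]; congr 1; push_cast; ring
    have h4 : 3 / 4 ≤ Real.exp (-w ^ 2 / 4) := by nlinarith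
    rw [h3]; nlinarith
  rw [inv_mul_eq_div, le_div_iff₀ hs0]
  linarith

theorem one_sub_stdNormalCdf_le {w : ℝ} (hw : 0 ≤ w) :
    1 - stdNormalCdf w ≤ 5 * stdNormalPdf w := by
  rcases le_total w 1 with h | h
  · linarith [one_fifth_le_stdNormalPdf hw h, stdNormalCdf_nonneg w]
  · nlinarith [mul_one_sub_stdNormalCdf_le w, stdNormalPdf_pos w, stdNormalCdf_le_one w]

theorem stdNormalPdf_le_one (w : ℝ) : stdNormalPdf w ≤ 1 := by
  rw [stdNormalPdf_eq]
  have hs : 1 ≤ √(2 * Real.pi) := by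
    rw [Real.one_le_sqrt]; linarith [Real.pi_gt_three]
  refine mul_le_one₀ (inv_le_one_of_one_le₀ hs) (Real.exp_pos _).le ?_
  rw [Real.exp_le_one_iff]; nlinarith [sq_nonneg w]

theorem abs_stdNormalCdf_sub_le (a b : ℝ) :
    |stdNormalCdf a - stdNormalCdf b| ≤ |a - b| := by
  have := Convex.norm_image_sub_le_of_norm_hasDerivWithin_le (f := stdNormalCdf)
    (f' := stdNormalPdf) (C := 1) (s := Set.univ) (x := b) (y := a)
    (fun x _ => (hasDerivAt_stdNormalCdf x).hasDerivWithinAt)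
    (fun x _ => by
      rw [Real.norm_eq_abs, abs_of_pos (stdNormalPdf_pos x)]; exact stdNormalPdf_le_one x)
    convex_univ (Set.mem_univ _) (Set.mem_univ _)
  simpa using this

/-- Lower bound for the normal tail, in the form of a Mills ratio estimate. -/
theorem exp_neg_sq_div_le_one_sub_stdNormalCdf {x : ℝ} (hx : 0 ≤ x) :
    Real.exp (-x ^ 2 / 2) ≤ 15 * (1 + x) * (1 - stdNormalCdf x) := by
  have hx1 : 0 < 1 + x := by linarith
  -- Over a step of length `1 / (1 + x)` the exponent `x² / 2` grows by at most `x d + d² / 2 ≤ 3 /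
  -- 2`, so the density drops only by a constant factor. The constant is `15 = 5 · 3`, from `exp
  -- (3/2) ≤ 5` and `√(2π) ≤ 3`.
  set d : ℝ := 1 / (1 + x) with hd
  have hd0 : 0 < d := by positivity
  have hd1 : d ≤ 1 := by rw [hd, div_le_one hx1]; linarith
  have hdx : d * (1 + x) = 1 := by rw [hd]; field_simp
  have hmv := Convex.mul_sub_le_image_sub_of_le_deriv (D := Set.Icc x (x + d)) (convex_Icc _ _)
    (f := stdNormalCdf) continuous_stdNormalCdf.continuousOn
    (fun y _ => (hasDerivAt_stdNormalCdf y).differentiableAt.differentiableWithinAt)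
    (C := stdNormalPdf (x + d)) (fun y hy => by
      rw [(hasDerivAt_stdNormalCdf y).deriv, stdNormalPdf_eq, stdNormalPdf_eq]
      rw [interior_Icc] at hy
      have : -(x + d) ^ 2 / 2 ≤ -y ^ 2 / 2 := by nlinarith [hy.1, hy.2]
      gcongr)
    x ⟨le_rfl, by linarith⟩ (x + d) ⟨by linarith, le_rfl⟩ (by linarith)
  have h1 := stdNormalCdf_le_one (x + d)
  have hs : √(2 * Real.pi) ≤ 13 / 5 := by
    rw [Real.sqrt_le_left (by norm_num)]
    nlinarith [Real.pi_lt_d2]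
  have hs0 : 0 < √(2 * Real.pi) := by positivity
  have he : Real.exp (-x ^ 2 / 2) ≤ 15 * stdNormalPdf (x + d) := by
    rw [stdNormalPdf_eq]
    have h2 : -x ^ 2 / 2 - 3 / 2 ≤ -(x + d) ^ 2 / 2 := by nlinarith
    have h3 : Real.exp (-x ^ 2 / 2) * Real.exp (-(3 / 2)) ≤ Real.exp (-(x + d) ^ 2 / 2) := by
      rw [← Real.exp_add]; exact Real.exp_le_exp.2 (by linarith)
    have h4 : Real.exp (3 / 2) ≤ 5 := by
      have h := Real.exp_one_lt_d9
      have : Real.exp (3 / 2) ^ 2 = Real.exp 1 ^ 3 := by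
        rw [← Real.exp_nat_mul, ← Real.exp_nat_mul]; norm_num
      have h5 : Real.exp 1 ^ 3 ≤ 2.72 ^ 3 := by
        gcongr; linarith
      nlinarith [Real.exp_pos (3 / 2)]
    have h6 : Real.exp (-x ^ 2 / 2) ≤ 5 * Real.exp (-(x + d) ^ 2 / 2) := by
      rw [Real.exp_neg] at h3
      have h7 : 0 < Real.exp (3 / 2) := Real.exp_pos _
      rw [← div_eq_mul_inv, div_le_iff₀ h7] at h3
      nlinarith [Real.exp_pos (-(x + d) ^ 2 / 2)]
    have h8 : (1 : ℝ) / 3 ≤ (√(2 * Real.pi))⁻¹ := by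
      rw [one_div]; exact inv_anti₀ hs0 (by linarith)
    nlinarith [Real.exp_pos (-(x + d) ^ 2 / 2)]
  have h9 : stdNormalPdf (x + d) * d ≤ 1 - stdNormalCdf x := by
    have : x + d - x = d := by ring
    rw [this] at hmv; linarith
  calc Real.exp (-x ^ 2 / 2) ≤ 15 * stdNormalPdf (x + d) := he
    _ = 15 * (1 + x) * (stdNormalPdf (x + d) * d) := by
        linear_combination (-15 * stdNormalPdf (x + d)) * hdx
    _ ≤ _ := by gcongr

/-! ### Stein's equation for a half line. -/

/-- The bounded solution of Stein's equation for the half line `(-∞, z)`. -/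
noncomputable def steinSol (z w : ℝ) : ℝ :=
  stdNormalCdf (min w z) * (1 - stdNormalCdf (max w z)) / stdNormalPdf w

/-- The right derivative of `steinSol`. -/
noncomputable def steinDeriv (z w : ℝ) : ℝ :=
  w * steinSol z w + Set.indicator (Set.Iio z) 1 w - stdNormalCdf z

theorem continuous_steinSol (z : ℝ) : Continuous (steinSol z) := by
  unfold steinSol
  refine Continuous.div ?_ continuous_stdNormalPdf fun w => (stdNormalPdf_pos w).ne'
  exact (continuous_stdNormalCdf.comp (by fun_prop)).mul
    (continuous_const.sub (continuous_stdNormalCdf.comp (by fun_prop)))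

theorem measurable_steinDeriv (z : ℝ) : Measurable (steinDeriv z) := by
  unfold steinDeriv
  exact ((measurable_id.mul (continuous_steinSol z).measurable).add
    (measurable_one.indicator measurableSet_Iio)).sub_const _

theorem steinSol_nonneg (z w : ℝ) : 0 ≤ steinSol z w :=
  div_nonneg (mul_nonneg (stdNormalCdf_nonneg _) (by linarith [stdNormalCdf_le_one (max w z)]))
    (stdNormalPdf_pos w).le

theorem steinSol_mul_pdf_le (z w : ℝ) :
    steinSol z w * stdNormalPdf w ≤ stdNormalCdf w ∧
      steinSol z w * stdNormalPdf w ≤ 1 - stdNormalCdf w := by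
  rw [steinSol, div_mul_cancel₀ _ (stdNormalPdf_pos w).ne']
  have h1 := monotone_stdNormalCdf (min_le_left w z)
  have h2 := monotone_stdNormalCdf (le_max_left w z)
  have h3 := stdNormalCdf_nonneg (min w z)
  have h4 := stdNormalCdf_le_one (max w z)
  have h5 := stdNormalCdf_nonneg w
  have h6 := stdNormalCdf_le_one w
  constructor <;> nlinarith

/-- Whatever `z` is, the solution is at most the smaller normal tail at `w` divided by the density,
so Mills' ratio bounds it; the case `w ≤ 0` follows by symmetry. -/
theorem steinSol_bounds (z w : ℝ) : steinSol z w ≤ 5 ∧ |w * steinSol z w| ≤ 1 := by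
  obtain ⟨h1, h2⟩ := steinSol_mul_pdf_le z w
  have h0 := steinSol_nonneg z w
  have hp := stdNormalPdf_pos w
  rcases le_total 0 w with hw | hw
  · refine ⟨le_of_mul_le_mul_right (h2.trans (one_sub_stdNormalCdf_le hw)) hp, ?_⟩
    rw [abs_of_nonneg (mul_nonneg hw h0)]
    refine le_of_mul_le_mul_right ?_ hp
    calc w * steinSol z w * stdNormalPdf w = w * (steinSol z w * stdNormalPdf w) := by ring
      _ ≤ w * (1 - stdNormalCdf w) := by gcongr
      _ ≤ 1 * stdNormalPdf w := by rw [one_mul]; exact mul_one_sub_stdNormalCdf_le w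
  · have hw' : 0 ≤ -w := by linarith
    have e : 1 - stdNormalCdf (-w) = stdNormalCdf w := by rw [stdNormalCdf_neg]; ring
    have b1 := one_sub_stdNormalCdf_le hw'
    have b2 := mul_one_sub_stdNormalCdf_le (-w)
    rw [e, stdNormalPdf_neg] at b1 b2
    refine ⟨le_of_mul_le_mul_right (h1.trans b1) hp, ?_⟩
    rw [abs_mul, abs_of_nonpos hw, abs_of_nonneg h0]
    refine le_of_mul_le_mul_right ?_ hp
    calc -w * steinSol z w * stdNormalPdf w = -w * (steinSol z w * stdNormalPdf w) := by ring
      _ ≤ -w * stdNormalCdf w := by gcongr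
      _ ≤ 1 * stdNormalPdf w := by rw [one_mul]; exact b2

theorem abs_steinDeriv_le (z w : ℝ) : |steinDeriv z w| ≤ 2 := by
  have h := abs_le.1 (steinSol_bounds z w).2
  have h1 := stdNormalCdf_nonneg z
  have h2 := stdNormalCdf_le_one z
  have h3 : (Set.indicator (Set.Iio z) 1 w : ℝ) ∈ Set.Icc (0 : ℝ) 1 := by
    by_cases hw : w ∈ Set.Iio z <;> simp [hw]
  rw [steinDeriv, abs_le]
  constructor <;> linarith [h3.1, h3.2, h.1, h.2]

/-- The solution has a corner at `w = z`. There the right-hand branch applies, in agreement with the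
indicator of the open half line in `steinDeriv`, so a right derivative exists everywhere and the
mean value inequality for right derivatives needs no exceptional point. -/
theorem hasDerivWithinAt_steinSol (z w : ℝ) :
    HasDerivWithinAt (steinSol z) (steinDeriv z w) (Set.Ici w) w := by
  have hp := (stdNormalPdf_pos w).ne'
  rcases lt_or_ge w z with hw | hw
  · have hd : HasDerivAt (fun u => stdNormalCdf u * (1 - stdNormalCdf z) / stdNormalPdf u)
        (steinDeriv z w) w := by
      refine (((hasDerivAt_stdNormalCdf w).mul_const (1 - stdNormalCdf z)).fun_div
        (hasDerivAt_stdNormalPdf w) hp).congr_deriv ?_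
      rw [steinDeriv, steinSol, min_eq_left hw.le, max_eq_right hw.le,
        Set.indicator_of_mem (Set.mem_Iio.2 hw), Pi.one_apply]
      field_simp
      ring
    refine (hd.congr_of_eventuallyEq ?_).hasDerivWithinAt
    filter_upwards [Iio_mem_nhds hw] with u hu
    rw [steinSol, min_eq_left (le_of_lt hu), max_eq_right (le_of_lt hu)]
  · have hd : HasDerivAt (fun u => stdNormalCdf z * (1 - stdNormalCdf u) / stdNormalPdf u)
        (steinDeriv z w) w := by
      refine ((((hasDerivAt_stdNormalCdf w).const_sub 1).const_mul (stdNormalCdf z)).fun_div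
        (hasDerivAt_stdNormalPdf w) hp).congr_deriv ?_
      rw [steinDeriv, steinSol, min_eq_right hw, max_eq_left hw,
        Set.indicator_of_notMem (by simpa using hw)]
      field_simp
      ring
    refine hd.hasDerivWithinAt.congr (fun u hu => ?_) ?_
    · have : z ≤ u := hw.trans hu
      rw [steinSol, min_eq_right this, max_eq_left this]
    · rw [steinSol, min_eq_right hw, max_eq_left hw]

/-- First order expansion estimate for a continuous function with a right derivative that is
close to a constant. -/
theorem abs_sub_sub_mul_le_of_rightDeriv {f f' : ℝ → ℝ} (hf : Continuous f)
    (hf' : ∀ w, HasDerivWithinAt f (f' w) (Set.Ici w) w) {w s c K : ℝ}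
    (h : ∀ u, |u - w| ≤ |s| → |f' u - c| ≤ K) :
    |f (w + s) - f w - s * c| ≤ |s| * K := by
  have key : ∀ a b : ℝ, a ≤ b → (∀ u ∈ Set.Ico a b, |f' u - c| ≤ K) →
      |f b - f a - (b - a) * c| ≤ K * (b - a) := by
    intro a b hab hK
    have := norm_image_sub_le_of_norm_deriv_right_le_segment (f := fun u => f u - u * c)
      (f' := fun u => f' u - c) (a := a) (b := b) (C := K) (by fun_prop)
      (fun u _ => by
        have := (hf' u).fun_sub ((hasDerivWithinAt_id u (Set.Ici u)).mul_const c)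
        simpa using this)
      (fun u hu => hK u hu) b ⟨hab, le_rfl⟩
    rw [Real.norm_eq_abs] at this
    convert this using 2; ring
  rcases le_total 0 s with hs | hs
  · have := key w (w + s) (by linarith) fun u hu => h u (by
      rw [abs_of_nonneg (by linarith [hu.1]), abs_of_nonneg hs]; linarith [hu.2])
    rw [abs_of_nonneg hs]
    convert this using 1
    · congr 1; ring
    · ring
  · have := key (w + s) w (by linarith) fun u hu => h u (by
      rw [abs_of_nonpos (by linarith [hu.2]), abs_of_nonpos hs]; linarith [hu.1])
    rw [abs_of_nonpos hs]
    rw [abs_sub_comm] at this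
    convert this using 1
    · congr 1; ring
    · ring

theorem abs_steinSol_sub_le (z w u : ℝ) : |steinSol z u - steinSol z w| ≤ 2 * |u - w| := by
  have := abs_sub_sub_mul_le_of_rightDeriv (continuous_steinSol z) (hasDerivWithinAt_steinSol z)
    (w := w) (s := u - w) (c := 0) (K := 2) (fun v _ => by simpa using abs_steinDeriv_le z v)
  simp at this
  linarith

/-- Modulus of continuity of `steinDeriv z` at `w`, at scale `r`. -/
noncomputable def steinModulus (z w r : ℝ) : ℝ :=
  r * (5 + 2 * |w|) + if |w - z| ≤ r then 1 else 0

/-- The term `w f(w)` is continuous with an increment controlled by `f ≤ 5` and the Lipschitz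
constant `2`. The indicator changes only if `z` separates `u` from `w`, which forces `|w - z| ≤ r`.
-/
theorem abs_steinDeriv_sub_le (z : ℝ) {w u r : ℝ} (h : |u - w| ≤ r) :
    |steinDeriv z u - steinDeriv z w| ≤ steinModulus z w r := by
  have h1 : |u * steinSol z u - w * steinSol z w| ≤ r * (5 + 2 * |w|) := by
    have e : u * steinSol z u - w * steinSol z w
        = (u - w) * steinSol z u + w * (steinSol z u - steinSol z w) := by ring
    rw [e]
    refine (abs_add_le _ _).trans ?_
    rw [abs_mul, abs_mul, abs_of_nonneg (steinSol_nonneg z u)]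
    have a1 := (steinSol_bounds z u).1
    have a2 := abs_steinSol_sub_le z w u
    have a3 := steinSol_nonneg z u
    have : |u - w| * steinSol z u ≤ r * 5 := by
      exact mul_le_mul h a1 a3 ((abs_nonneg _).trans h)
    have : |w| * |steinSol z u - steinSol z w| ≤ |w| * (2 * r) := by
      gcongr; linarith
    linarith
  have h2 : |Set.indicator (Set.Iio z) (1 : ℝ → ℝ) u - Set.indicator (Set.Iio z) 1 w|
      ≤ if |w - z| ≤ r then 1 else 0 := by
    rw [abs_le] at h
    by_cases hu : u < z <;> by_cases hw : w < z
    · simp [hu, hw]; split_ifs <;> norm_num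
    · have : |w - z| ≤ r := by rw [abs_le]; constructor <;> linarith
      simp [hu, hw, this]
    · have : |w - z| ≤ r := by rw [abs_le]; constructor <;> linarith
      simp [hu, hw, this]
    · simp [hu, hw]; split_ifs <;> norm_num
  have e : steinDeriv z u - steinDeriv z w = (u * steinSol z u - w * steinSol z w) +
      (Set.indicator (Set.Iio z) (1 : ℝ → ℝ) u - Set.indicator (Set.Iio z) 1 w) := by
    unfold steinDeriv; ring
  rw [e, steinModulus]
  exact (abs_add_le _ _).trans (add_le_add h1 h2)

theorem abs_steinSol_taylor_le (z w s : ℝ) :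
    |steinSol z (w + s) - steinSol z w - s * steinDeriv z w| ≤ |s| * steinModulus z w |s| :=
  abs_sub_sub_mul_le_of_rightDeriv (continuous_steinSol z) (hasDerivWithinAt_steinSol z)
    fun _ hu => abs_steinDeriv_sub_le z hu

/-! ### Concentration of independent sums on intervals. -/

theorem indepFun_sum_erase {Ω : Type*} [MeasurableSpace Ω] {μ : Measure Ω} {ι : Type*}
    {X : ι → Ω → ℝ} (hm : ∀ i, Measurable (X i)) (hind : iIndepFun X μ)
    [DecidableEq ι] (s : Finset ι) (j : ι) :
    IndepFun (fun ω => ∑ i ∈ s.erase j, X i ω) (X j) μ := by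
  have := hind.indepFun_finsetSum_of_notMem hm (Finset.notMem_erase j s)
  convert this using 1
  ext ω; simp

section Concentration

variable {Ω : Type*} [MeasurableSpace Ω] {μ : Measure Ω} [IsProbabilityMeasure μ]

theorem integrable_abs_pow_of_memLp_three {Y : Ω → ℝ} (hY : MemLp Y 3 μ) {k : ℕ} (hk : k ≤ 3) :
    Integrable (fun ω => |Y ω| ^ k) μ :=
  integrable_norm_pow_of_le hY.aestronglyMeasurable hk
    (by have := hY.integrable_norm_pow (p := 3) (by norm_num); exact this)

theorem integrable_sq_of_memLp_three {Y : Ω → ℝ} (hY : MemLp Y 3 μ) :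
    Integrable (fun ω => Y ω ^ 2) μ := by
  simpa using integrable_abs_pow_of_memLp_three hY (k := 2) (by norm_num)

theorem integrable_of_memLp_three {Y : Ω → ℝ} (hY : MemLp Y 3 μ) : Integrable Y μ :=
  hY.integrable (by norm_num)

theorem integral_abs_le_of_integral_sq {Y : Ω → ℝ} (hY : MemLp Y 2 μ) :
    ∫ ω, |Y ω| ∂μ ≤ (1 + ∫ ω, Y ω ^ 2 ∂μ) / 2 := by
  have h1 : ∫ ω, |Y ω| ∂μ ≤ ∫ ω, (1 + Y ω ^ 2) / 2 ∂μ :=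
    integral_mono (hY.integrable (by norm_num)).abs
      (((integrable_const 1).add hY.integrable_sq).div_const 2)
      fun ω => by nlinarith [sq_nonneg (|Y ω| - 1), sq_abs (Y ω)]
  rwa [integral_div, integral_add (integrable_const 1) hY.integrable_sq, integral_const,
    probReal_univ, one_smul] at h1

variable {ι : Type*} {X : ι → Ω → ℝ}

theorem integral_sum_sq_of_indep (hm : ∀ i, Measurable (X i)) (hind : iIndepFun X μ)
    (h2 : ∀ i, MemLp (X i) 2 μ) (h0 : ∀ i, ∫ ω, X i ω ∂μ = 0) (s : Finset ι) :
    ∫ ω, (∑ i ∈ s, X i ω) ^ 2 ∂μ = ∑ i ∈ s, ∫ ω, X i ω ^ 2 ∂μ := by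
  have hv := IndepFun.variance_sum (μ := μ) (X := X) (s := s) (fun i _ => h2 i)
    (fun i _ j _ hij => hind.indepFun hij)
  have h3 : ∀ i ∈ s, variance (X i) μ = ∫ ω, X i ω ^ 2 ∂μ := fun i _ =>
    variance_of_integral_eq_zero (hm i).aemeasurable (h0 i)
  rw [Finset.sum_congr rfl h3, variance_of_integral_eq_zero] at hv
  · simpa [Finset.sum_apply] using hv
  · rw [Finset.sum_fn]
    exact (Finset.measurable_fun_sum s fun i _ => hm i).aemeasurable
  · simp only [Finset.sum_apply]
    rw [integral_finsetSum _ fun i _ => (h2 i).integrable (by norm_num)]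
    exact Finset.sum_eq_zero fun i _ => h0 i

/-- The identity truncated at level `L`, centred at `c`. -/
noncomputable def clampAt (c L w : ℝ) : ℝ := max (-L) (min L (w - c))

theorem continuous_clampAt (c L : ℝ) : Continuous (clampAt c L) := by
  unfold clampAt; fun_prop

theorem abs_clampAt_le {c L : ℝ} (hL : 0 ≤ L) (w : ℝ) : |clampAt c L w| ≤ L := by
  rw [clampAt, abs_le]
  exact ⟨le_max_left _ _, max_le (by linarith) (min_le_left _ _)⟩

theorem monotone_clampAt (c L : ℝ) : Monotone (clampAt c L) := fun u v h => by
  unfold clampAt; gcongr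

theorem mul_clampAt_sub_nonneg (c L v x : ℝ) :
    0 ≤ x * (clampAt c L v - clampAt c L (v - x)) := by
  rcases le_total 0 x with hx | hx
  · exact mul_nonneg hx (sub_nonneg.2 (monotone_clampAt c L (by linarith)))
  · exact mul_nonneg_of_nonpos_of_nonpos hx (sub_nonpos.2 (monotone_clampAt c L (by linarith)))

/-- At distance at least `δ` from both truncation points the clamp has slope one, so moving by `x`
changes it by at least `min |x| δ`, in the direction of the sign of `x`. -/
theorem abs_mul_min_le_mul_clampAt_sub {c L δ v x : ℝ} (hδ : 0 ≤ δ) (h : |v - c| ≤ L - δ) :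
    |x| * min |x| δ ≤ x * (clampAt c L v - clampAt c L (v - x)) := by
  obtain ⟨h1, h2⟩ := abs_le.1 h
  have hv : clampAt c L v = v - c := by
    rw [clampAt, min_eq_right (by linarith), max_eq_right (by linarith)]
  rw [hv]
  rcases le_total 0 x with hx | hx
  · rw [abs_of_nonneg hx]
    refine mul_le_mul_of_nonneg_left ?_ hx
    have : clampAt c L (v - x) ≤ max (-L) (v - x - c) := max_le_max le_rfl (min_le_right _ _)
    rcases max_cases (-L) (v - x - c) with ⟨e, _⟩ | ⟨e, _⟩
    · linarith [min_le_right x δ]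
    · linarith [min_le_left x δ]
  · rw [abs_of_nonpos hx]
    have : min L (v - x - c) ≤ clampAt c L (v - x) := le_max_right _ _
    have h3 : min (-x) δ ≤ clampAt c L (v - x) - (v - c) := by
      rcases min_cases L (v - x - c) with ⟨e, _⟩ | ⟨e, _⟩
      · linarith [min_le_right (-x) δ]
      · linarith [min_le_left (-x) δ]
    nlinarith

theorem sq_sub_le_abs_mul_min {δ : ℝ} (hδ : 0 < δ) (x : ℝ) :
    x ^ 2 - |x| ^ 3 / (4 * δ) ≤ |x| * min |x| δ := by
  have hx := abs_nonneg x
  have hd : 0 < 4 * δ := by positivity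
  rcases min_cases |x| δ with ⟨e, _⟩ | ⟨e, _⟩ <;> rw [e]
  · have : 0 ≤ |x| ^ 3 / (4 * δ) := by positivity
    nlinarith [sq_abs x]
  · rw [sub_le_iff_le_add, ← sub_le_iff_le_add', le_div_iff₀ hd, ← sq_abs x]
    nlinarith [mul_nonneg hx (sq_nonneg (|x| - 2 * δ))]

/-- Concentration inequality for sums of independent random variables. -/
theorem measureReal_sum_mem_Icc_le (hm : ∀ i, Measurable (X i)) (hind : iIndepFun X μ)
    (h3 : ∀ i, MemLp (X i) 3 μ) (h0 : ∀ i, ∫ ω, X i ω ∂μ = 0) (s : Finset ι) {β : ℝ}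
    (hβ0 : 0 < β) (hβ : ∑ i ∈ s, ∫ ω, |X i ω| ^ 3 ∂μ ≤ β)
    (hlo : 1 / 4 ≤ ∑ i ∈ s, ∫ ω, X i ω ^ 2 ∂μ) (hhi : ∑ i ∈ s, ∫ ω, X i ω ^ 2 ∂μ ≤ 3 / 2)
    {a b : ℝ} (hab : a ≤ b) :
    μ.real {ω | a ≤ ∑ i ∈ s, X i ω ∧ ∑ i ∈ s, X i ω ≤ b} ≤ 5 * (b - a) + 40 * β := by
  classical
  have h2 : ∀ i, MemLp (X i) 2 μ := fun i => (h3 i).mono_exponent (by norm_num)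
  set V : Ω → ℝ := fun ω => ∑ i ∈ s, X i ω with hV
  have hVm : Measurable V := Finset.measurable_fun_sum s fun i _ => hm i
  have hVsq : ∫ ω, V ω ^ 2 ∂μ = ∑ i ∈ s, ∫ ω, X i ω ^ 2 ∂μ :=
    integral_sum_sq_of_indep hm hind h2 h0 s
  have hV2 : MemLp V 2 μ := memLp_finsetSum s fun i _ => h2 i
  have hVabs : ∫ ω, |V ω| ∂μ ≤ 5 / 4 := by
    have := integral_abs_le_of_integral_sq hV2
    linarith
  -- This scale makes the cubic loss `β / (4 δ)` equal to `1 / 8`, half of the lower bound on the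
  -- variance. Hence the mean `h` of `H` below is at least `1 / 8`.
  set δ : ℝ := 2 * β with hδ
  have hδ0 : 0 < δ := by positivity
  set c : ℝ := (a + b) / 2 with hc
  set L : ℝ := (b - a) / 2 + δ with hL
  have hL0 : 0 ≤ L := by rw [hL]; linarith
  set A : Set Ω := {ω | a ≤ V ω ∧ V ω ≤ b} with hA
  have hAm : MeasurableSet A :=
    (measurableSet_le measurable_const hVm).inter (measurableSet_le hVm measurable_const)
  set η : ι → Ω → ℝ := fun i ω => |X i ω| * min |X i ω| δ with hη
  have hηm : ∀ i, Measurable (η i) := fun i => by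
    have := hm i
    simp only [hη]; fun_prop
  have hηnn : ∀ i ω, 0 ≤ η i ω := fun i ω =>
    mul_nonneg (abs_nonneg _) (le_min (abs_nonneg _) hδ0.le)
  have hηle : ∀ i ω, η i ω ≤ δ * |X i ω| := fun i ω => by
    rw [mul_comm δ]
    exact mul_le_mul_of_nonneg_left (min_le_right _ _) (abs_nonneg _)
  have hη2 : ∀ i, MemLp (η i) 2 μ := fun i =>
    (h2 i).of_le_mul (c := δ) (hηm i).aestronglyMeasurable (ae_of_all _ fun ω => by
      rw [Real.norm_eq_abs, Real.norm_eq_abs, abs_of_nonneg (hηnn i ω)]; exact hηle i ω)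
  have hηint : ∀ i, Integrable (η i) μ := fun i => (hη2 i).integrable (by norm_num)
  set H : Ω → ℝ := fun ω => ∑ i ∈ s, η i ω with hH
  have hHint : Integrable H μ := integrable_finsetSum s fun i _ => hηint i
  have hH2 : MemLp H 2 μ := memLp_finsetSum s fun i _ => hη2 i
  set h : ℝ := ∫ ω, H ω ∂μ with hh
  have hhlo : 1 / 8 ≤ h := by
    have e1 : h = ∑ i ∈ s, ∫ ω, η i ω ∂μ := integral_finsetSum s fun i _ => hηint i
    have e2 : ∀ i ∈ s, (∫ ω, X i ω ^ 2 ∂μ) - (∫ ω, |X i ω| ^ 3 ∂μ) / (4 * δ) ≤ ∫ ω, η i ω ∂μ := by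
      intro i _
      have i3 := integrable_abs_pow_of_memLp_three (h3 i) (k := 3) le_rfl
      rw [← integral_div, ← integral_sub (h2 i).integrable_sq (i3.div_const _)]
      exact integral_mono ((h2 i).integrable_sq.sub (i3.div_const _)) (hηint i)
        fun ω => sq_sub_le_abs_mul_min hδ0 _
    have e3 := Finset.sum_le_sum e2
    rw [Finset.sum_sub_distrib, ← Finset.sum_div, ← e1] at e3
    have e4 : (∑ i ∈ s, ∫ ω, |X i ω| ^ 3 ∂μ) / (4 * δ) ≤ 1 / 8 := by
      rw [div_le_iff₀ (by positivity)]
      rw [hδ]; linarith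
    linarith
  have hvar : ∫ ω, (H ω - h) ^ 2 ∂μ ≤ δ ^ 2 * (3 / 2) := by
    have hηind : iIndepFun η μ :=
      hind.comp (fun _ x => |x| * min |x| δ) fun _ => by fun_prop
    have hv := IndepFun.variance_sum (μ := μ) (X := η) (s := s) (fun i _ => hη2 i)
      (fun i _ j _ hij => hηind.indepFun hij)
    have e : (∑ i ∈ s, η i) = H := by ext ω; simp [hH]
    rw [e, variance_eq_integral hH2.aemeasurable] at hv
    rw [hv]
    have : ∀ i ∈ s, variance (η i) μ ≤ δ ^ 2 * ∫ ω, X i ω ^ 2 ∂μ := fun i _ => by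
      refine (variance_le_expectation_sq (hηm i).aestronglyMeasurable).trans ?_
      rw [← integral_const_mul]
      refine integral_mono (hη2 i).integrable_sq ((h2 i).integrable_sq.const_mul _) fun ω => ?_
      simp only [Pi.pow_apply]
      calc η i ω ^ 2 ≤ (δ * |X i ω|) ^ 2 := by
            exact pow_le_pow_left₀ (hηnn i ω) (hηle i ω) 2
        _ = δ ^ 2 * X i ω ^ 2 := by rw [mul_pow, sq_abs]
    refine (Finset.sum_le_sum this).trans ?_
    rw [← Finset.mul_sum]
    gcongr
  -- The variance of `H` is of order `δ²`, and `|t| ≤ t² / (2 δ) + δ / 2` balances the two terms at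
  -- scale `δ`.
  have hdev : ∫ ω, |H ω - h| ∂μ ≤ 5 / 4 * δ := by
    have i1 : Integrable (fun ω => H ω - h) μ := hHint.sub (integrable_const _)
    have i2 : Integrable (fun ω => (H ω - h) ^ 2) μ := (hH2.sub (memLp_const h)).integrable_sq
    have e : ∫ ω, |H ω - h| ∂μ ≤ ∫ ω, (H ω - h) ^ 2 / (2 * δ) + δ / 2 ∂μ := by
      refine integral_mono i1.abs ((i2.div_const _).add (integrable_const _)) fun ω => ?_
      simp only
      rw [← sub_le_iff_le_add, le_div_iff₀ (by positivity), ← sq_abs (H ω - h)]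
      nlinarith [sq_nonneg (|H ω - h| - δ)]
    rw [integral_add (i2.div_const _) (integrable_const _), integral_div, integral_const,
      probReal_univ, one_smul] at e
    have : (∫ ω, (H ω - h) ^ 2 ∂μ) / (2 * δ) ≤ 3 / 4 * δ := by
      rw [div_le_iff₀ (by positivity)]; nlinarith
    linarith
  set f := clampAt c L with hf
  have hfm : Measurable f := (continuous_clampAt c L).measurable
  have hfb : ∀ w, ‖f w‖ ≤ L := abs_clampAt_le hL0
  have hbd : ∀ {Y Z : Ω → ℝ}, Integrable Y μ → Measurable Z →
      Integrable (fun ω => Y ω * f (Z ω)) μ := fun hY hZ =>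
    hY.mul_bdd (c := L) (hfm.comp hZ).aestronglyMeasurable (ae_of_all _ fun ω => hfb _)
  have hXint : ∀ i, Integrable (X i) μ := fun i => integrable_of_memLp_three (h3 i)
  -- Subtracting `f` at the leave-one-out sum changes nothing in the mean, by independence and
  -- centring. The integrand is then nonnegative everywhere and at least `η i` on `A`.
  have hterm : ∀ i ∈ s, ∫ ω in A, η i ω ∂μ ≤ ∫ ω, X i ω * f (V ω) ∂μ := by
    intro i hi
    set Vi : Ω → ℝ := fun ω => ∑ j ∈ s.erase i, X j ω with hVi
    have hVim : Measurable Vi := Finset.measurable_fun_sum _ fun j _ => hm j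
    have hVe : ∀ ω, Vi ω = V ω - X i ω := fun ω => by
      rw [hVi, hV]; simp only
      rw [← Finset.add_sum_erase s (fun j => X j ω) hi]; ring
    have hz : ∫ ω, X i ω * f (Vi ω) ∂μ = 0 := by
      have hi' : IndepFun (X i) (f ∘ Vi) μ :=
        (indepFun_sum_erase hm hind s i).symm.comp measurable_id hfm
      have := hi'.integral_fun_mul_eq_mul_integral (hm i).aestronglyMeasurable
        (hfm.comp hVim).aestronglyMeasurable
      rw [h0 i, zero_mul] at this
      exact this
    have e : ∫ ω, X i ω * f (V ω) ∂μ = ∫ ω, X i ω * (f (V ω) - f (V ω - X i ω)) ∂μ := by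
      rw [← sub_zero (∫ ω, X i ω * f (V ω) ∂μ), ← hz,
        ← integral_sub (hbd (hXint i) hVm) (hbd (hXint i) hVim)]
      refine integral_congr_ae (ae_of_all _ fun ω => ?_)
      simp only [hVe]; ring
    rw [e, ← integral_indicator hAm]
    refine integral_mono ((hηint i).indicator hAm) ?_ fun ω => ?_
    · refine ((hbd (hXint i) hVm).sub (hbd (hXint i) hVim)).congr (ae_of_all _ fun ω => ?_)
      simp only [hVe, Pi.sub_apply]; ring
    · by_cases hω : ω ∈ A
      · rw [Set.indicator_of_mem hω]
        refine abs_mul_min_le_mul_clampAt_sub hδ0.le ?_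
        rw [abs_le, hL, hc]
        constructor <;> linarith [hω.1, hω.2]
      · rw [Set.indicator_of_notMem hω]
        exact mul_clampAt_sub_nonneg c L _ _
  have hsum : ∫ ω in A, H ω ∂μ ≤ ∫ ω, V ω * f (V ω) ∂μ := by
    have e1 : ∫ ω in A, H ω ∂μ = ∑ i ∈ s, ∫ ω in A, η i ω ∂μ :=
      integral_finsetSum s fun i _ => (hηint i).integrableOn
    have e2 : ∫ ω, V ω * f (V ω) ∂μ = ∑ i ∈ s, ∫ ω, X i ω * f (V ω) ∂μ := by
      rw [← integral_finsetSum s fun i _ => hbd (hXint i) hVm]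
      simp only [hV, Finset.sum_mul]
    rw [e1, e2]
    exact Finset.sum_le_sum hterm
  have hup : ∫ ω, V ω * f (V ω) ∂μ ≤ L * (5 / 4) := by
    have hVint : Integrable V μ := hV2.integrable (by norm_num)
    refine (integral_mono (hbd hVint hVm) (hVint.abs.const_mul L) fun ω => ?_).trans ?_
    · calc V ω * f (V ω) ≤ |V ω * f (V ω)| := le_abs_self _
        _ = |f (V ω)| * |V ω| := by rw [abs_mul, mul_comm]
        _ ≤ L * |V ω| := mul_le_mul_of_nonneg_right (hfb _) (abs_nonneg _)
    · rw [integral_const_mul]; gcongr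
  -- `H` and the event `A` are dependent; replacing `H` by its mean on `A` costs only its mean
  -- absolute deviation.
  have hlow : h * μ.real A - 5 / 4 * δ ≤ ∫ ω in A, H ω ∂μ := by
    have i1 : Integrable (fun ω => H ω - h) μ := hHint.sub (integrable_const _)
    have e1 : ∫ ω in A, (h - |H ω - h|) ∂μ ≤ ∫ ω in A, H ω ∂μ := by
      refine integral_mono ((integrable_const _).sub i1.abs).integrableOn hHint.integrableOn
        fun ω => ?_
      simp only
      linarith [neg_abs_le (H ω - h)]
    rw [integral_sub (integrable_const _) i1.abs.integrableOn, integral_const,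
      measureReal_restrict_apply_univ, smul_eq_mul] at e1
    have e2 : ∫ ω in A, |H ω - h| ∂μ ≤ ∫ ω, |H ω - h| ∂μ :=
      setIntegral_le_integral i1.abs (ae_of_all _ fun ω => abs_nonneg _)
    linarith
  have hP : 0 ≤ μ.real A := measureReal_nonneg
  have : 1 / 8 * μ.real A ≤ h * μ.real A := by gcongr
  have e5 : L * (5 / 4) = 5 / 8 * (b - a) + 5 / 2 * β := by rw [hL, hδ]; ring
  rw [e5] at hup
  have e6 : 5 / 4 * δ = 5 / 2 * β := by rw [hδ]; ring
  rw [e6] at hlow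
  linarith

end Concentration

/-! ### The Berry–Esseen bound by Stein's method. -/

section BerryEsseen

variable {Ω : Type*} [MeasurableSpace Ω] {μ : Measure Ω} [IsProbabilityMeasure μ]

/-- Lyapunov's inequality for the first three absolute moments. -/
theorem exists_lyapunov_root {Y : Ω → ℝ} (hY : MemLp Y 3 μ) :
    ∃ g : ℝ, 0 ≤ g ∧ g ^ 3 = ∫ ω, |Y ω| ^ 3 ∂μ ∧ ∫ ω, |Y ω| ∂μ ≤ g ∧ ∫ ω, Y ω ^ 2 ∂μ ≤ g ^ 2 := by
  have i1 : Integrable (fun ω => |Y ω|) μ := (integrable_of_memLp_three hY).abs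
  have i2 := integrable_sq_of_memLp_three hY
  have i3 := integrable_abs_pow_of_memLp_three hY (k := 3) le_rfl
  set ρ : ℝ := ∫ ω, |Y ω| ^ 3 ∂μ with hρ
  have hρ0 : 0 ≤ ρ := integral_nonneg fun ω => by positivity
  set g : ℝ := ρ ^ ((3 : ℕ)⁻¹ : ℝ) with hg
  have hg0 : 0 ≤ g := Real.rpow_nonneg hρ0 _
  have hg3 : g ^ 3 = ρ := Real.rpow_inv_natCast_pow hρ0 (by norm_num)
  -- Young's inequality with parameter `h` requires division by a power of `h`. Taking `h > g` keeps
  -- it positive even if `g = 0`; then `h` decreases to `g`.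
  have key : ∀ h : ℝ, g < h → ∫ ω, |Y ω| ∂μ ≤ h ∧ ∫ ω, Y ω ^ 2 ∂μ ≤ h ^ 2 := by
    intro h hh
    have hpos : 0 < h := hg0.trans_lt hh
    have hle : ρ ≤ h ^ 3 := hg3 ▸ pow_le_pow_left₀ hg0 hh.le 3
    constructor
    · have e : ∫ ω, |Y ω| * h ^ 2 ∂μ ≤ ∫ ω, (|Y ω| ^ 3 / 3 + 2 * h ^ 3 / 3) ∂μ := by
        refine integral_mono (i1.mul_const _) ((i3.div_const _).add (integrable_const _)) fun ω => ?_
        simp only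
        nlinarith [mul_nonneg (add_nonneg (abs_nonneg (Y ω)) (by positivity : 0 ≤ 2 * h))
          (sq_nonneg (|Y ω| - h))]
      rw [integral_mul_const, integral_add (i3.div_const _) (integrable_const _), integral_div,
        integral_const, probReal_univ, one_smul] at e
      refine le_of_mul_le_mul_right (?_ : _ ≤ h * h ^ 2) (by positivity : 0 < h ^ 2)
      calc _ ≤ _ := e
        _ ≤ _ := by linarith [show h * h ^ 2 = h ^ 3 by ring]
    · have e : ∫ ω, Y ω ^ 2 * h ∂μ ≤ ∫ ω, (|Y ω| ^ 3 * (2 / 3) + h ^ 3 / 3) ∂μ := by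
        refine integral_mono (i2.mul_const _) ((i3.mul_const _).add (integrable_const _)) fun ω => ?_
        simp only
        rw [← sq_abs (Y ω)]
        nlinarith [mul_nonneg (add_nonneg (mul_nonneg two_pos.le (abs_nonneg (Y ω))) hpos.le)
          (sq_nonneg (|Y ω| - h))]
      rw [integral_mul_const, integral_add (i3.mul_const _) (integrable_const _),
        integral_mul_const, integral_const, probReal_univ, one_smul] at e
      refine le_of_mul_le_mul_right (?_ : _ ≤ h ^ 2 * h) hpos
      calc _ ≤ _ := e
        _ ≤ _ := by linarith [show h ^ 2 * h = h ^ 3 by ring]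
  refine ⟨g, hg0, hg3, ?_, ?_⟩
  · exact le_of_forall_gt_imp_ge_of_dense fun h hh => (key h hh).1
  · have ht : Filter.Tendsto (fun h : ℝ => h ^ 2) (nhdsWithin g (Set.Ioi g)) (nhds (g ^ 2)) :=
      ((continuous_pow 2).tendsto g).mono_left nhdsWithin_le_nhds
    refine ge_of_tendsto ht ?_
    filter_upwards [self_mem_nhdsWithin] with h hh using (key h hh).2

/-- By independence and Fubini one may freeze `U` and apply the concentration bound for `V` at the
random radius `|U|`. -/
theorem integral_mul_indicator_abs_sub_le {U V : Ω → ℝ} (hU : Measurable U) (hV : Measurable V)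
    (hind : IndepFun U V μ) {z c d : ℝ}
    (hc : ∀ r : ℝ, 0 ≤ r → μ.real {ω | |V ω - z| ≤ r} ≤ c * r + d)
    {g : ℝ → ℝ} (hg : Measurable g) (hg0 : ∀ u, 0 ≤ g u) (hgi : Integrable (fun ω => g (U ω)) μ)
    (hgi' : Integrable (fun ω => g (U ω) * |U ω|) μ) :
    Integrable (fun ω => g (U ω) * if |V ω - z| ≤ |U ω| then 1 else 0) μ ∧
    ∫ ω, g (U ω) * (if |V ω - z| ≤ |U ω| then 1 else 0) ∂μ ≤
      c * (∫ ω, g (U ω) * |U ω| ∂μ) + d * ∫ ω, g (U ω) ∂μ := by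
  have : IsProbabilityMeasure (μ.map U) := Measure.isProbabilityMeasure_map hU.aemeasurable
  have : IsProbabilityMeasure (μ.map V) := Measure.isProbabilityMeasure_map hV.aemeasurable
  set F : ℝ × ℝ → ℝ := fun p => g p.1 * if |p.2 - z| ≤ |p.1| then 1 else 0 with hF
  have hS : MeasurableSet {p : ℝ × ℝ | |p.2 - z| ≤ |p.1|} :=
    measurableSet_le (by fun_prop) (by fun_prop)
  have hFm : Measurable F :=
    (hg.comp measurable_fst).mul (Measurable.ite hS measurable_const measurable_const)
  have hFb : ∀ p, ‖F p‖ ≤ g p.1 := fun p => by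
    rw [hF]; simp only
    split_ifs <;> simp [abs_of_nonneg (hg0 p.1), hg0 p.1]
  have hgU : Integrable g (μ.map U) :=
    (integrable_map_measure hg.aestronglyMeasurable hU.aemeasurable).2 hgi
  have hFi : Integrable F ((μ.map U).prod (μ.map V)) :=
    (hgU.comp_fst (μ.map V)).mono' hFm.aestronglyMeasurable (ae_of_all _ hFb)
  have hmap : μ.map (fun ω => (U ω, V ω)) = (μ.map U).prod (μ.map V) :=
    (indepFun_iff_map_prod_eq_prod_map_map hU.aemeasurable hV.aemeasurable).1 hind
  have hUV : Measurable fun ω => (U ω, V ω) := hU.prodMk hV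
  refine ⟨hgi.mono' (hFm.comp hUV).aestronglyMeasurable (ae_of_all _ fun ω => hFb (U ω, V ω)), ?_⟩
  have e1 : ∫ ω, g (U ω) * (if |V ω - z| ≤ |U ω| then 1 else 0) ∂μ
      = ∫ p, F p ∂((μ.map U).prod (μ.map V)) := by
    rw [← hmap, integral_map hUV.aemeasurable hFm.aestronglyMeasurable]
  have e2 : ∀ u, ∫ v, F (u, v) ∂(μ.map V) = g u * μ.real {ω | |V ω - z| ≤ |u|} := fun u => by
    have hSu : MeasurableSet {v : ℝ | |v - z| ≤ |u|} :=
      measurableSet_le (by fun_prop) measurable_const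
    simp only [hF]
    rw [integral_const_mul]
    congr 1
    have : (fun v : ℝ => if |v - z| ≤ |u| then (1 : ℝ) else 0)
        = Set.indicator {v : ℝ | |v - z| ≤ |u|} 1 := by
      ext v; simp [Set.indicator_apply]
    rw [this, integral_indicator_one hSu, map_measureReal_apply hV hSu]
    rfl
  have e3 : ∫ p, F p ∂((μ.map U).prod (μ.map V))
      = ∫ ω, g (U ω) * μ.real {ω' | |V ω' - z| ≤ |U ω|} ∂μ := by
    rw [integral_prod _ hFi]
    rw [integral_map hU.aemeasurable hFi.aestronglyMeasurable.integral_prod_right']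
    simp only [e2]
  rw [e1, e3, ← integral_const_mul, ← integral_const_mul,
    ← integral_add (hgi'.const_mul _) (hgi.const_mul _)]
  refine integral_mono_of_nonneg (ae_of_all _ fun ω => mul_nonneg (hg0 _) measureReal_nonneg)
    ((hgi'.const_mul _).add (hgi.const_mul _)) (ae_of_all _ fun ω => ?_)
  calc g (U ω) * μ.real {ω' | |V ω' - z| ≤ |U ω|} ≤ g (U ω) * (c * |U ω| + d) :=
        mul_le_mul_of_nonneg_left (hc _ (abs_nonneg _)) (hg0 _)
    _ = _ := by ring

theorem integral_mul_steinModulus_le {U V : Ω → ℝ} (hU : Measurable U) (hV : Measurable V)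
    (hind : IndepFun U V μ) (hVi : Integrable V μ) {z c d K : ℝ}
    (hc : ∀ r : ℝ, 0 ≤ r → μ.real {ω | |V ω - z| ≤ r} ≤ c * r + d)
    (hK : 5 + 2 * ∫ ω, |V ω| ∂μ ≤ K)
    {g : ℝ → ℝ} (hg : Measurable g) (hg0 : ∀ u, 0 ≤ g u) (hgi : Integrable (fun ω => g (U ω)) μ)
    (hgi' : Integrable (fun ω => g (U ω) * |U ω|) μ) :
    Integrable (fun ω => g (U ω) * steinModulus z (V ω) |U ω|) μ ∧
    ∫ ω, g (U ω) * steinModulus z (V ω) |U ω| ∂μ ≤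
      (K + c) * (∫ ω, g (U ω) * |U ω| ∂μ) + d * ∫ ω, g (U ω) ∂μ := by
  obtain ⟨j1, j2⟩ := integral_mul_indicator_abs_sub_le hU hV hind hc hg hg0 hgi hgi'
  have hi : IndepFun (fun ω => g (U ω) * |U ω|) (fun ω => 5 + 2 * |V ω|) μ :=
    hind.comp (φ := fun u => g u * |u|) (ψ := fun v => 5 + 2 * |v|)
      (hg.mul (by fun_prop)) (by fun_prop)
  have hVi' : Integrable (fun ω => 5 + 2 * |V ω|) μ :=
    (integrable_const _).add (hVi.abs.const_mul 2)
  have j3 : Integrable (fun ω => (g (U ω) * |U ω|) * (5 + 2 * |V ω|)) μ :=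
    hi.integrable_mul hgi' hVi'
  have j4 : ∫ ω, (g (U ω) * |U ω|) * (5 + 2 * |V ω|) ∂μ
      = (∫ ω, g (U ω) * |U ω| ∂μ) * ∫ ω, (5 + 2 * |V ω|) ∂μ :=
    hi.integral_fun_mul_eq_mul_integral hgi'.aestronglyMeasurable hVi'.aestronglyMeasurable
  have e : (fun ω => g (U ω) * steinModulus z (V ω) |U ω|) = fun ω =>
      (g (U ω) * |U ω|) * (5 + 2 * |V ω|) + g (U ω) * if |V ω - z| ≤ |U ω| then 1 else 0 := by
    funext ω; rw [steinModulus]; ring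
  rw [e]
  refine ⟨j3.add j1, ?_⟩
  rw [integral_add j3 j1, j4, integral_add (integrable_const _) (hVi.abs.const_mul 2),
    integral_const, probReal_univ, one_smul, integral_const_mul]
  have : (∫ ω, g (U ω) * |U ω| ∂μ) * (5 + 2 * ∫ ω, |V ω| ∂μ) ≤ (∫ ω, g (U ω) * |U ω| ∂μ) * K :=
    mul_le_mul_of_nonneg_left hK (integral_nonneg fun ω => mul_nonneg (hg0 _) (abs_nonneg _))
  linarith

/-- One summand of Stein's identity, with the leave-one-out sum `V`. -/
theorem abs_integral_mul_steinSol_sub_le {U V : Ω → ℝ} (hU : Measurable U) (hV : Measurable V)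
    (hind : IndepFun U V μ) (hU3 : MemLp U 3 μ) (hU0 : ∫ ω, U ω ∂μ = 0) (hVi : Integrable V μ)
    {z c d K : ℝ} (hc0 : 0 ≤ c) (hK0 : 0 ≤ K)
    (hc : ∀ r : ℝ, 0 ≤ r → μ.real {ω | |V ω - z| ≤ r} ≤ c * r + d)
    (hK : 5 + 2 * ∫ ω, |V ω| ∂μ ≤ K) :
    |∫ ω, U ω * steinSol z (V ω + U ω) ∂μ
        - (∫ ω, U ω ^ 2 ∂μ) * ∫ ω, steinDeriv z (V ω + U ω) ∂μ| ≤
      2 * ((K + c) * (∫ ω, |U ω| ^ 3 ∂μ) + d * ∫ ω, U ω ^ 2 ∂μ) := by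
  have i1 : Integrable U μ := integrable_of_memLp_three hU3
  have i2 := integrable_sq_of_memLp_three hU3
  have i3 := integrable_abs_pow_of_memLp_three hU3 (k := 3) le_rfl
  have hfm : Measurable (steinSol z) := (continuous_steinSol z).measurable
  have hf'm := measurable_steinDeriv z
  have hfb : ∀ w, ‖steinSol z w‖ ≤ 5 := fun w => by
    rw [Real.norm_eq_abs, abs_of_nonneg (steinSol_nonneg z w)]; exact (steinSol_bounds z w).1
  have hf'b : ∀ w, ‖steinDeriv z w‖ ≤ 2 := abs_steinDeriv_le z
  have hVU : Measurable fun ω => V ω + U ω := hV.add hU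
  have k1 : Integrable (fun ω => U ω * steinSol z (V ω + U ω)) μ :=
    i1.mul_bdd (hfm.comp hVU).aestronglyMeasurable (ae_of_all _ fun _ => hfb _)
  have k2 : Integrable (fun ω => U ω * steinSol z (V ω)) μ :=
    i1.mul_bdd (hfm.comp hV).aestronglyMeasurable (ae_of_all _ fun _ => hfb _)
  have k3 : Integrable (fun ω => U ω ^ 2 * steinDeriv z (V ω)) μ :=
    i2.mul_bdd (hf'm.comp hV).aestronglyMeasurable (ae_of_all _ fun _ => hf'b _)
  have k4 : Integrable (fun ω => steinDeriv z (V ω + U ω)) μ :=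
    Integrable.of_bound (hf'm.comp hVU).aestronglyMeasurable 2 (ae_of_all _ fun _ => hf'b _)
  have k5 : Integrable (fun ω => steinDeriv z (V ω)) μ :=
    Integrable.of_bound (hf'm.comp hV).aestronglyMeasurable 2 (ae_of_all _ fun _ => hf'b _)
  have z2 : ∫ ω, U ω * steinSol z (V ω) ∂μ = 0 := by
    have hi : IndepFun U (steinSol z ∘ V) μ := hind.comp measurable_id hfm
    have := hi.integral_fun_mul_eq_mul_integral hU.aestronglyMeasurable
      (hfm.comp hV).aestronglyMeasurable
    rw [hU0, zero_mul] at this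
    exact this
  have z3 : ∫ ω, U ω ^ 2 * steinDeriv z (V ω) ∂μ
      = (∫ ω, U ω ^ 2 ∂μ) * ∫ ω, steinDeriv z (V ω) ∂μ := by
    have hi : IndepFun (fun ω => U ω ^ 2) (fun ω => steinDeriv z (V ω)) μ :=
      hind.comp (φ := fun u => u ^ 2) (by fun_prop) hf'm
    exact hi.integral_fun_mul_eq_mul_integral i2.aestronglyMeasurable k5.aestronglyMeasurable
  have c2 : ∀ ω, U ω ^ 2 * |U ω| = |U ω| ^ 3 := fun ω => by rw [← sq_abs]; ring
  obtain ⟨m1, m2⟩ := integral_mul_steinModulus_le hU hV hind hVi hc hK (g := fun u => u ^ 2)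
    (by fun_prop) (fun u => sq_nonneg u) i2 (by simpa only [c2] using i3)
  obtain ⟨n1, n2⟩ := integral_mul_steinModulus_le hU hV hind hVi hc hK (g := fun _ => 1)
    measurable_const (fun u => zero_le_one) (integrable_const _) (by simpa using i1.abs)
  simp only [c2] at m2
  simp only [one_mul, integral_const, probReal_univ, one_smul, mul_one] at n1 n2
  -- First-order expansion of the Stein solution around `V`; the zeroth-order term has mean zero.
  have a1 : |∫ ω, U ω * steinSol z (V ω + U ω) ∂μ - ∫ ω, U ω ^ 2 * steinDeriv z (V ω) ∂μ|
      ≤ ∫ ω, U ω ^ 2 * steinModulus z (V ω) |U ω| ∂μ := by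
    have e : ∫ ω, U ω * steinSol z (V ω + U ω) ∂μ - ∫ ω, U ω ^ 2 * steinDeriv z (V ω) ∂μ
        = ∫ ω, (U ω * steinSol z (V ω + U ω) - U ω * steinSol z (V ω)
          - U ω ^ 2 * steinDeriv z (V ω)) ∂μ := by
      have k12 : Integrable (fun ω => U ω * steinSol z (V ω + U ω) - U ω * steinSol z (V ω)) μ :=
        k1.sub k2
      rw [integral_sub k12 k3, integral_sub k1 k2, z2, sub_zero]
    rw [e]
    refine (abs_integral_le_integral_abs).trans (integral_mono ((k1.sub k2).sub k3).abs m1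
      fun ω => ?_)
    have e2 : U ω * steinSol z (V ω + U ω) - U ω * steinSol z (V ω)
          - U ω ^ 2 * steinDeriv z (V ω)
        = U ω * (steinSol z (V ω + U ω) - steinSol z (V ω) - U ω * steinDeriv z (V ω)) := by ring
    simp only
    rw [e2, abs_mul, ← sq_abs (U ω), sq, mul_assoc]
    exact mul_le_mul_of_nonneg_left (abs_steinSol_taylor_le z _ _) (abs_nonneg _)
  have a2 : |∫ ω, steinDeriv z (V ω) ∂μ - ∫ ω, steinDeriv z (V ω + U ω) ∂μ|
      ≤ ∫ ω, steinModulus z (V ω) |U ω| ∂μ := by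
    rw [abs_sub_comm, ← integral_sub k4 k5]
    refine (abs_integral_le_integral_abs).trans (integral_mono (k4.sub k5).abs n1 fun ω => ?_)
    exact abs_steinDeriv_sub_le z (by simp)
  have hs0 : 0 ≤ ∫ ω, U ω ^ 2 ∂μ := integral_nonneg fun ω => sq_nonneg _
  -- Lyapunov brings the cost of replacing the derivative at `V` by that at `V + U` to the same form
  -- as the expansion error, whence the factor `2` in the conclusion.
  have a3 : (∫ ω, U ω ^ 2 ∂μ) * ∫ ω, |U ω| ∂μ ≤ ∫ ω, |U ω| ^ 3 ∂μ := by
    obtain ⟨g, g0, g3, g1, g2⟩ := exists_lyapunov_root hU3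
    rw [← g3]
    calc _ ≤ g ^ 2 * g := mul_le_mul g2 g1 (integral_nonneg fun ω => abs_nonneg _) (by positivity)
      _ = g ^ 3 := by ring
  have a4 : |(∫ ω, U ω ^ 2 ∂μ) * (∫ ω, steinDeriv z (V ω) ∂μ)
      - (∫ ω, U ω ^ 2 ∂μ) * ∫ ω, steinDeriv z (V ω + U ω) ∂μ|
      ≤ (K + c) * (∫ ω, |U ω| ^ 3 ∂μ) + d * ∫ ω, U ω ^ 2 ∂μ := by
    rw [← mul_sub, abs_mul, abs_of_nonneg hs0]
    calc _ ≤ (∫ ω, U ω ^ 2 ∂μ) * ((K + c) * (∫ ω, |U ω| ∂μ) + d) :=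
          mul_le_mul_of_nonneg_left (a2.trans n2) hs0
      _ = (K + c) * ((∫ ω, U ω ^ 2 ∂μ) * ∫ ω, |U ω| ∂μ) + d * ∫ ω, U ω ^ 2 ∂μ := by ring
      _ ≤ _ := by gcongr
  rw [z3] at a1
  have := abs_sub_le (∫ ω, U ω * steinSol z (V ω + U ω) ∂μ)
    ((∫ ω, U ω ^ 2 ∂μ) * ∫ ω, steinDeriv z (V ω) ∂μ)
    ((∫ ω, U ω ^ 2 ∂μ) * ∫ ω, steinDeriv z (V ω + U ω) ∂μ)
  linarith

/-- **Berry–Esseen theorem** for sums of independent random variables with total variance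
close to `1`. -/
theorem abs_measureReal_sum_lt_sub_stdNormalCdf_le {ι : Type*} [Fintype ι] {X : ι → Ω → ℝ}
    (hm : ∀ i, Measurable (X i)) (hind : iIndepFun X μ) (h3 : ∀ i, MemLp (X i) 3 μ)
    (h0 : ∀ i, ∫ ω, X i ω ∂μ = 0) {β : ℝ} (hβ0 : 0 < β)
    (hβ : ∑ i, ∫ ω, |X i ω| ^ 3 ∂μ ≤ β) (z : ℝ) :
    |μ.real {ω | ∑ i, X i ω < z} - stdNormalCdf z| ≤
      140 * (β + |∑ i, ∫ ω, X i ω ^ 2 ∂μ - 1|) := by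
  classical
  set B : ℝ := ∑ i, ∫ ω, X i ω ^ 2 ∂μ with hB
  set W : Ω → ℝ := fun ω => ∑ i, X i ω with hW
  have triv : |μ.real {ω | W ω < z} - stdNormalCdf z| ≤ 1 := by
    have h1 : μ.real {ω | W ω < z} ≤ 1 := measureReal_le_one
    have h2 : 0 ≤ μ.real {ω | W ω < z} := measureReal_nonneg
    rw [abs_le]
    constructor <;> linarith [stdNormalCdf_nonneg z, stdNormalCdf_le_one z]
  -- Otherwise `β + |B - 1|` exceeds `1 / 64` and the trivial bound `1` is enough. In the main case
  -- each single variance is at most `1 / 2`, so every leave-one-out sum keeps variance at least `1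
  -- / 4`, as the concentration inequality requires.
  by_cases hcase : β ≤ 1 / 64 ∧ |B - 1| ≤ 1 / 4
  swap
  · have : 1 / 64 ≤ β + |B - 1| := by
      by_contra hcon
      have := abs_nonneg (B - 1)
      exact hcase ⟨by linarith, by linarith⟩
    linarith
  obtain ⟨hβ1, hB1⟩ := hcase
  obtain ⟨hB2, hB3⟩ := abs_le.1 hB1
  have h2 : ∀ i, MemLp (X i) 2 μ := fun i => (h3 i).mono_exponent (by norm_num)
  have hρ0 : ∀ i, 0 ≤ ∫ ω, |X i ω| ^ 3 ∂μ := fun i => integral_nonneg fun ω => by positivity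
  have hσ0 : ∀ i, 0 ≤ ∫ ω, X i ω ^ 2 ∂μ := fun i => integral_nonneg fun ω => sq_nonneg _
  have hWm : Measurable W := Finset.measurable_fun_sum _ fun i _ => hm i
  have hterm : ∀ i, |∫ ω, X i ω * steinSol z (W ω) ∂μ
      - (∫ ω, X i ω ^ 2 ∂μ) * ∫ ω, steinDeriv z (W ω) ∂μ| ≤
      2 * ((8 + 10) * (∫ ω, |X i ω| ^ 3 ∂μ) + 40 * β * ∫ ω, X i ω ^ 2 ∂μ) := by
    intro i
    set V : Ω → ℝ := fun ω => ∑ j ∈ Finset.univ.erase i, X j ω with hV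
    have hVm : Measurable V := Finset.measurable_fun_sum _ fun j _ => hm j
    have hV2 : MemLp V 2 μ := memLp_finsetSum _ fun j _ => h2 j
    have hWV : ∀ ω, W ω = V ω + X i ω := fun ω =>
      (Finset.sum_erase_add _ _ (Finset.mem_univ i)).symm
    have hBi : ∑ j ∈ Finset.univ.erase i, ∫ ω, X j ω ^ 2 ∂μ = B - ∫ ω, X i ω ^ 2 ∂μ := by
      rw [hB, ← Finset.sum_erase_add _ _ (Finset.mem_univ i)]; ring
    have hρi : ∫ ω, |X i ω| ^ 3 ∂μ ≤ β :=
      (Finset.single_le_sum (f := fun i => ∫ ω, |X i ω| ^ 3 ∂μ) (fun j _ => hρ0 j)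
        (Finset.mem_univ i)).trans hβ
    have hβi : ∑ j ∈ Finset.univ.erase i, ∫ ω, |X j ω| ^ 3 ∂μ ≤ β :=
      (Finset.sum_le_sum_of_subset_of_nonneg (Finset.erase_subset _ _) fun j _ _ => hρ0 j).trans hβ
    have hσi : ∫ ω, X i ω ^ 2 ∂μ ≤ 1 / 2 := by
      obtain ⟨g, g0, g3, -, g2⟩ := exists_lyapunov_root (h3 i)
      have : g ≤ 1 / 4 := by
        by_contra! hg
        have := pow_lt_pow_left₀ hg (by norm_num) (three_ne_zero)
        norm_num at this
        linarith
      nlinarith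
    have hVsq : ∫ ω, V ω ^ 2 ∂μ = B - ∫ ω, X i ω ^ 2 ∂μ := by
      rw [← hBi]; exact integral_sum_sq_of_indep hm hind h2 h0 _
    have hVabs := integral_abs_le_of_integral_sq hV2
    have hK : 5 + 2 * ∫ ω, |V ω| ∂μ ≤ 8 := by
      have := hσ0 i
      linarith
    have hc : ∀ r : ℝ, 0 ≤ r → μ.real {ω | |V ω - z| ≤ r} ≤ 10 * r + 40 * β := by
      intro r hr
      have := measureReal_sum_mem_Icc_le hm hind h3 h0 (Finset.univ.erase i) hβ0 hβi
        (by linarith) (by linarith [hσ0 i]) (a := z - r) (b := z + r) (by linarith)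
      have e : {ω | |V ω - z| ≤ r} = {ω | z - r ≤ V ω ∧ V ω ≤ z + r} := by
        ext ω
        simp only [Set.mem_ofPred_eq, abs_le]
        constructor <;> rintro ⟨p, q⟩ <;> constructor <;> linarith
      rw [e]
      linarith
    simp only [hWV]
    exact abs_integral_mul_steinSol_sub_le (hm i) hVm (indepFun_sum_erase hm hind _ i).symm (h3 i)
      (h0 i) (hV2.integrable (by norm_num)) (by norm_num) (by norm_num) hc hK
  have hfm : Measurable (steinSol z) := (continuous_steinSol z).measurable
  have hfb : ∀ w, ‖steinSol z w‖ ≤ 5 := fun w => by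
    rw [Real.norm_eq_abs, abs_of_nonneg (steinSol_nonneg z w)]; exact (steinSol_bounds z w).1
  have hXf : ∀ i, Integrable (fun ω => X i ω * steinSol z (W ω)) μ := fun i =>
    (integrable_of_memLp_three (h3 i)).mul_bdd (hfm.comp hWm).aestronglyMeasurable
      (ae_of_all _ fun _ => hfb _)
  have hWf : ∫ ω, W ω * steinSol z (W ω) ∂μ = ∑ i, ∫ ω, X i ω * steinSol z (W ω) ∂μ := by
    rw [← integral_finsetSum _ fun i _ => hXf i]
    simp only [hW, Finset.sum_mul]
  have hWfi : Integrable (fun ω => W ω * steinSol z (W ω)) μ := by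
    have := integrable_finsetSum Finset.univ fun i _ => hXf i
    refine this.congr (ae_of_all _ fun ω => ?_)
    simp only [hW, Finset.sum_mul]
  -- Summing gives `2 (18 β + 40 β B)`, and `B ≤ 5 / 4`.
  have hmain : |∫ ω, W ω * steinSol z (W ω) ∂μ - B * ∫ ω, steinDeriv z (W ω) ∂μ| ≤ 136 * β := by
    rw [hWf, hB, Finset.sum_mul, ← Finset.sum_sub_distrib]
    refine (Finset.abs_sum_le_sum_abs _ _).trans ((Finset.sum_le_sum fun i _ => hterm i).trans ?_)
    rw [← Finset.mul_sum, Finset.sum_add_distrib, ← Finset.mul_sum, ← Finset.mul_sum, ← hB]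
    nlinarith
  have hset : MeasurableSet {ω | W ω < z} := measurableSet_lt hWm measurable_const
  have hind1 : Integrable (Set.indicator {ω | W ω < z} (1 : Ω → ℝ)) μ :=
    (integrable_const (1 : ℝ)).indicator hset
  have hderiv : ∫ ω, steinDeriv z (W ω) ∂μ
      = ∫ ω, W ω * steinSol z (W ω) ∂μ + μ.real {ω | W ω < z} - stdNormalCdf z := by
    have e : (fun ω => steinDeriv z (W ω)) = fun ω => W ω * steinSol z (W ω)
        + Set.indicator {ω | W ω < z} (1 : Ω → ℝ) ω - stdNormalCdf z := by
      funext ω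
      rw [steinDeriv]
      rfl
    have hadd : Integrable (fun ω => W ω * steinSol z (W ω)
        + Set.indicator {ω | W ω < z} (1 : Ω → ℝ) ω) μ := hWfi.add hind1
    rw [e, integral_sub hadd (integrable_const _), integral_add hWfi hind1,
      integral_indicator_one hset, integral_const, probReal_univ, one_smul]
  have hder2 : |∫ ω, steinDeriv z (W ω) ∂μ| ≤ 2 := by
    have := norm_integral_le_of_norm_le_const (μ := μ) (f := fun ω => steinDeriv z (W ω)) (C := 2)
      (ae_of_all _ fun ω => abs_steinDeriv_le z _)
    simpa using this
  have e : μ.real {ω | W ω < z} - stdNormalCdf z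
      = -((B - 1) * ∫ ω, steinDeriv z (W ω) ∂μ)
        - (∫ ω, W ω * steinSol z (W ω) ∂μ - B * ∫ ω, steinDeriv z (W ω) ∂μ) := by
    rw [hderiv]; ring
  have f1 : |(B - 1) * ∫ ω, steinDeriv z (W ω) ∂μ| ≤ |B - 1| * 2 := by
    rw [abs_mul]; gcongr
  rw [e]
  refine (abs_sub _ _).trans ?_
  rw [abs_neg]
  linarith [abs_nonneg (B - 1)]

end BerryEsseen

/-! ### Exponential moments and tilting of one variable. -/

theorem memLp_three_of_integrable_abs_pow {Ω : Type*} [MeasurableSpace Ω] {μ : Measure Ω}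
    {Y : Ω → ℝ} (hY : AEStronglyMeasurable Y μ) (h : Integrable (fun ω => |Y ω| ^ 3) μ) :
    MemLp Y 3 μ := by
  rw [← integrable_norm_rpow_iff hY (by norm_num) (by norm_num)]
  refine h.congr (ae_of_all _ fun ω => ?_)
  simp only [Real.norm_eq_abs]
  rw [show (3 : ℝ≥0∞).toReal = ((3 : ℕ) : ℝ) by simp, Real.rpow_natCast]

theorem abs_exp_sub_one_sub_sub_le (u : ℝ) :
    |Real.exp u - 1 - u - u ^ 2 / 2| ≤ |u| ^ 3 * Real.exp |u| := by
  have := Complex.norm_exp_sub_sum_le_norm_mul_exp (u : ℂ) 3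
  rw [← Complex.ofReal_exp] at this
  simp only [Finset.sum_range_succ, Finset.sum_range_zero, Nat.factorial] at this
  norm_cast at this
  simp only [Real.norm_eq_abs] at this
  convert this using 2
  simp
  ring

theorem abs_exp_sub_one_sub_le (u : ℝ) :
    |Real.exp u - 1 - u| ≤ |u| ^ 2 * Real.exp |u| := by
  have := Complex.norm_exp_sub_sum_le_norm_mul_exp (u : ℂ) 2
  rw [← Complex.ofReal_exp] at this
  simp only [Finset.sum_range_succ, Finset.sum_range_zero, Nat.factorial] at this
  norm_cast at this
  simp only [Real.norm_eq_abs] at this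
  convert this using 2
  simp
  ring

theorem abs_exp_sub_one_le_mul_exp (u : ℝ) :
    |Real.exp u - 1| ≤ |u| * Real.exp |u| := by
  have := Complex.norm_exp_sub_sum_le_norm_mul_exp (u : ℂ) 1
  rw [← Complex.ofReal_exp] at this
  simp only [Finset.sum_range_succ, Finset.sum_range_zero, Nat.factorial] at this
  norm_cast at this
  simp only [Real.norm_eq_abs] at this
  convert this using 2
  · simp
  · simp

/-- If `b ≤ G²`, `1 ≤ M` and `M - 1` is at most of the order `x² b + x³ G³`, then
`b (1 - 1 / M)` is of the order `x G³`. -/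
theorem mul_one_sub_inv_le {x b G M : ℝ} (hx : 0 ≤ x) (hG : 0 ≤ G) (hb : 0 ≤ b) (hbG : b ≤ G ^ 2)
    (hM1 : 1 ≤ M) (hM : M ≤ 1 + x ^ 2 * b / 2 + x ^ 3 * G ^ 3) :
    b * (1 - M⁻¹) ≤ 2 * (x * G ^ 3) := by
  have hMi : 0 ≤ M⁻¹ := inv_nonneg.2 (by linarith)
  have hMM : M * M⁻¹ = 1 := mul_inv_cancel₀ (by linarith)
  -- If `x G ≥ 1` then already `b ≤ G² ≤ x G³`. Otherwise `1 - 1 / M ≤ M - 1`, and the surplus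
  -- powers of `x G` are at most one.
  rcases le_total 1 (x * G) with h | h
  · have h1 : b * (1 - M⁻¹) ≤ b := by nlinarith
    have h2 : G ^ 2 ≤ x * G ^ 3 := by nlinarith [sq_nonneg G]
    have h3 : 0 ≤ x * G ^ 3 := by positivity
    linarith
  · have h1 : 1 - M⁻¹ ≤ M - 1 := by nlinarith
    have hxG : 0 ≤ x * G := mul_nonneg hx hG
    have h2 : b * (1 - M⁻¹) ≤ G ^ 2 * (x ^ 2 * G ^ 2 / 2 + x ^ 3 * G ^ 3) := by
      have h3 : 1 - M⁻¹ ≤ x ^ 2 * G ^ 2 / 2 + x ^ 3 * G ^ 3 := by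
        have : x ^ 2 * b ≤ x ^ 2 * G ^ 2 := by gcongr
        linarith
      have h4 : 0 ≤ x ^ 2 * G ^ 2 / 2 + x ^ 3 * G ^ 3 := by positivity
      exact (mul_le_mul_of_nonneg_left h3 hb).trans (mul_le_mul_of_nonneg_right hbG h4)
    have h5 : G ^ 2 * (x ^ 2 * G ^ 2 / 2 + x ^ 3 * G ^ 3)
        = (x * G ^ 3) * ((x * G) / 2 + (x * G) ^ 2) := by ring
    have h6 : (x * G) / 2 + (x * G) ^ 2 ≤ 2 := by nlinarith
    rw [h5] at h2
    have h7 : 0 ≤ x * G ^ 3 := by positivity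
    nlinarith

/-- Lower exponential bound for a quantity `M ≥ 1` with a second order expansion. -/
theorem exp_sub_le_of_expansion {x b G M : ℝ} (hx : 0 ≤ x) (hG : 0 ≤ G) (hb : 0 ≤ b)
    (hbG : b ≤ G ^ 2) (hM1 : 1 ≤ M) (hM : 1 + x ^ 2 * b / 2 - x ^ 3 * G ^ 3 ≤ M) :
    Real.exp (x ^ 2 * b / 2 - 2 * (x ^ 3 * G ^ 3)) ≤ M := by
  have hxG : 0 ≤ x * G := mul_nonneg hx hG
  have h1 : x ^ 2 * b ≤ (x * G) ^ 2 := by rw [mul_pow]; gcongr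
  have e3 : x ^ 3 * G ^ 3 = (x * G) ^ 3 := by ring
  rw [e3] at hM ⊢
  set u := x * G with hu
  set c := x ^ 2 * b / 2 with hc
  have hc0 : 0 ≤ c := by positivity
  -- For a nonpositive exponent `M ≥ 1` suffices. A positive one forces `u ≤ 1`, since `c ≤ u² / 2`;
  -- then `exp v ≤ 1 + v + v²` applies, and the quadratic term is at most `c² ≤ u³`, absorbed by the
  -- second copy of `u³`.
  by_cases hneg : c - 2 * u ^ 3 ≤ 0
  · exact (Real.exp_le_one_iff.2 hneg).trans hM1
  · push Not at hneg
    have hu1 : u ≤ 1 := by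
      by_contra! h
      have : u ^ 2 ≤ u ^ 3 := by nlinarith [sq_nonneg u]
      nlinarith [sq_nonneg u]
    have hc1 : c ≤ 1 / 2 := by nlinarith
    have hc2 : c ^ 2 ≤ u ^ 3 := by
      have : c ^ 2 ≤ (u ^ 2 / 2) ^ 2 := pow_le_pow_left₀ hc0 (by linarith) 2
      have h4 : u ^ 4 ≤ u ^ 3 := by
        have : 0 ≤ u ^ 3 := by positivity
        nlinarith
      have : 0 ≤ u ^ 4 := by positivity
      nlinarith
    have hy : 0 ≤ 2 * u ^ 3 := by positivity
    have := Real.abs_exp_sub_one_sub_id_le (x := c - 2 * u ^ 3) (by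
      rw [abs_of_pos hneg]; linarith)
    have h5 := (abs_le.1 this).2
    have h6 : (c - 2 * u ^ 3) ^ 2 ≤ c ^ 2 := pow_le_pow_left₀ hneg.le (by linarith) 2
    linarith

section OneVariable

variable {Ω : Type*} [MeasurableSpace Ω] {μ : Measure Ω} {Y : Ω → ℝ} {x : ℝ}

theorem integrable_abs_pow_mul_exp (hY : Measurable Y)
    (hexp : Integrable (fun ω => Real.exp (x * |Y ω|)) μ)
    (h3 : Integrable (fun ω => |Y ω| ^ 3 * Real.exp (x * |Y ω|)) μ) {k : ℕ} (hk : k ≤ 3)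
    {c : ℝ} (hc : |c| ≤ x) :
    Integrable (fun ω => |Y ω| ^ k * Real.exp (c * Y ω)) μ := by
  refine (hexp.add h3).mono' (by fun_prop) (ae_of_all _ fun ω => ?_)
  have h1 : |Y ω| ^ k ≤ 1 + |Y ω| ^ 3 := by
    rcases le_total |Y ω| 1 with h | h
    · have := pow_le_one₀ (n := k) (abs_nonneg _) h
      have : 0 ≤ |Y ω| ^ 3 := by positivity
      linarith
    · have := pow_le_pow_right₀ h hk
      linarith
  have h2 : c * Y ω ≤ x * |Y ω| := by
    calc c * Y ω ≤ |c * Y ω| := le_abs_self _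
      _ = |c| * |Y ω| := abs_mul _ _
      _ ≤ _ := by gcongr
  rw [Real.norm_eq_abs, abs_of_nonneg (by positivity)]
  simp only [Pi.add_apply]
  calc |Y ω| ^ k * Real.exp (c * Y ω) ≤ (1 + |Y ω| ^ 3) * Real.exp (x * |Y ω|) := by gcongr
    _ = _ := by ring

theorem memLp_three_of_integrable_mul_exp (hY : Measurable Y) (hx : 0 ≤ x)
    (hexp : Integrable (fun ω => Real.exp (x * |Y ω|)) μ)
    (h3 : Integrable (fun ω => |Y ω| ^ 3 * Real.exp (x * |Y ω|)) μ) : MemLp Y 3 μ :=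
  memLp_three_of_integrable_abs_pow hY.aestronglyMeasurable (by
    simpa using integrable_abs_pow_mul_exp hY hexp h3 (k := 3) le_rfl (c := 0) (by simpa))

variable [IsProbabilityMeasure μ]

/-- Expansions of the exponential moments of a centred random variable. -/
theorem abs_expMoment_sub_le (hY : Measurable Y)
    (hx : 0 ≤ x) (hexp : Integrable (fun ω => Real.exp (x * |Y ω|)) μ)
    (h3 : Integrable (fun ω => |Y ω| ^ 3 * Real.exp (x * |Y ω|)) μ) (h0 : ∫ ω, Y ω ∂μ = 0) :
    1 ≤ ∫ ω, Real.exp (x * Y ω) ∂μ ∧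
    |∫ ω, Real.exp (x * Y ω) ∂μ - 1 - x ^ 2 * (∫ ω, Y ω ^ 2 ∂μ) / 2| ≤
      x ^ 3 * ∫ ω, |Y ω| ^ 3 * Real.exp (x * |Y ω|) ∂μ ∧
    |∫ ω, Real.exp (x * Y ω) * Y ω ∂μ - x * ∫ ω, Y ω ^ 2 ∂μ| ≤
      x ^ 2 * ∫ ω, |Y ω| ^ 3 * Real.exp (x * |Y ω|) ∂μ ∧
    |∫ ω, Real.exp (x * Y ω) * Y ω ^ 2 ∂μ - ∫ ω, Y ω ^ 2 ∂μ| ≤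
      x * ∫ ω, |Y ω| ^ 3 * Real.exp (x * |Y ω|) ∂μ := by
  have hY3 := memLp_three_of_integrable_mul_exp hY hx hexp h3
  have i1 : Integrable Y μ := integrable_of_memLp_three hY3
  have i2 : Integrable (fun ω => Y ω ^ 2) μ := integrable_sq_of_memLp_three hY3
  have hxx : |x| ≤ x := (abs_of_nonneg hx).le
  have e0 : Integrable (fun ω => Real.exp (x * Y ω)) μ := by
    simpa using integrable_abs_pow_mul_exp hY hexp h3 (k := 0) (by norm_num) hxx
  have e1 : Integrable (fun ω => Real.exp (x * Y ω) * Y ω) μ := by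
    refine (integrable_abs_pow_mul_exp hY hexp h3 (k := 1) (by norm_num) hxx).mono'
      (by fun_prop) (ae_of_all _ fun ω => ?_)
    rw [Real.norm_eq_abs, abs_mul, abs_of_pos (Real.exp_pos _), pow_one, mul_comm]
  have e2 : Integrable (fun ω => Real.exp (x * Y ω) * Y ω ^ 2) μ := by
    refine (integrable_abs_pow_mul_exp hY hexp h3 (k := 2) (by norm_num) hxx).mono'
      (by fun_prop) (ae_of_all _ fun ω => ?_)
    rw [Real.norm_eq_abs, abs_mul, abs_of_pos (Real.exp_pos _), abs_of_nonneg (sq_nonneg _),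
      sq_abs, mul_comm]
  have hbound : ∀ {F : Ω → ℝ} {c : ℝ}, Integrable F μ →
      (∀ ω, |F ω| ≤ c * (|Y ω| ^ 3 * Real.exp (x * |Y ω|))) →
      |∫ ω, F ω ∂μ| ≤ c * ∫ ω, |Y ω| ^ 3 * Real.exp (x * |Y ω|) ∂μ := by
    intro F c hF hle
    rw [← integral_const_mul]
    exact abs_integral_le_integral_abs.trans (integral_mono hF.abs (h3.const_mul _) hle)
  have habs : ∀ ω, |x * Y ω| = x * |Y ω| := fun ω => by rw [abs_mul, abs_of_nonneg hx]
  refine ⟨?_, ?_, ?_, ?_⟩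
  · have : ∫ ω, (x * Y ω + 1) ∂μ ≤ ∫ ω, Real.exp (x * Y ω) ∂μ :=
      integral_mono ((i1.const_mul x).add (integrable_const _)) e0 fun ω => Real.add_one_le_exp _
    rw [integral_add (i1.const_mul x) (integrable_const _), integral_const_mul, h0] at this
    simpa using this
  · have j1 : Integrable (fun ω => Real.exp (x * Y ω) - 1) μ := e0.sub (integrable_const _)
    have j2 : Integrable (fun ω => Real.exp (x * Y ω) - 1 - x * Y ω) μ := j1.sub (i1.const_mul x)
    have j3 : Integrable (fun ω => x ^ 2 * Y ω ^ 2 / 2) μ := (i2.const_mul _).div_const 2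
    have e : ∫ ω, Real.exp (x * Y ω) ∂μ - 1 - x ^ 2 * (∫ ω, Y ω ^ 2 ∂μ) / 2
        = ∫ ω, (Real.exp (x * Y ω) - 1 - x * Y ω - x ^ 2 * Y ω ^ 2 / 2) ∂μ := by
      rw [integral_sub j2 j3, integral_sub j1 (i1.const_mul x), integral_sub e0 (integrable_const _),
        integral_div, integral_const_mul, integral_const_mul, h0]
      simp
    rw [e]
    refine hbound (j2.sub j3) fun ω => ?_
    have := abs_exp_sub_one_sub_sub_le (x * Y ω)
    rw [habs, mul_pow, mul_pow, mul_assoc] at this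
    exact this
  · have j1 : Integrable (fun ω => Real.exp (x * Y ω) * Y ω - Y ω) μ := e1.sub i1
    have e : ∫ ω, Real.exp (x * Y ω) * Y ω ∂μ - x * ∫ ω, Y ω ^ 2 ∂μ
        = ∫ ω, (Real.exp (x * Y ω) * Y ω - Y ω - x * Y ω ^ 2) ∂μ := by
      rw [integral_sub j1 (i2.const_mul _), integral_sub e1 i1, integral_const_mul, h0, sub_zero]
    rw [e]
    refine hbound (j1.sub (i2.const_mul _)) fun ω => ?_
    have := abs_exp_sub_one_sub_le (x * Y ω)
    rw [habs] at this
    have e' : Real.exp (x * Y ω) * Y ω - Y ω - x * Y ω ^ 2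
        = Y ω * (Real.exp (x * Y ω) - 1 - x * Y ω) := by ring
    rw [e', abs_mul]
    calc _ ≤ |Y ω| * ((x * |Y ω|) ^ 2 * Real.exp (x * |Y ω|)) := by gcongr
      _ = _ := by ring
  · rw [← integral_sub e2 i2]
    refine hbound (e2.sub i2) fun ω => ?_
    have := abs_exp_sub_one_le_mul_exp (x * Y ω)
    rw [habs] at this
    have e' : Real.exp (x * Y ω) * Y ω ^ 2 - Y ω ^ 2
        = Y ω ^ 2 * (Real.exp (x * Y ω) - 1) := by ring
    rw [e', abs_mul, abs_of_nonneg (sq_nonneg (Y ω)), ← sq_abs (Y ω)]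
    calc _ ≤ |Y ω| ^ 2 * (x * |Y ω| * Real.exp (x * |Y ω|)) := by gcongr
      _ = _ := by ring

/-- A common bound for the moments of `Y` under `μ` in terms of `E |Y|³ exp (x |Y|)`. -/
theorem exists_root_expMoment (hY : Measurable Y)
    (hx : 0 ≤ x) (hexp : Integrable (fun ω => Real.exp (x * |Y ω|)) μ)
    (h3 : Integrable (fun ω => |Y ω| ^ 3 * Real.exp (x * |Y ω|)) μ) :
    ∃ G : ℝ, 0 ≤ G ∧ G ^ 3 = ∫ ω, |Y ω| ^ 3 * Real.exp (x * |Y ω|) ∂μ ∧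
      ∫ ω, Y ω ^ 2 ∂μ ≤ G ^ 2 := by
  have hY3 := memLp_three_of_integrable_mul_exp hY hx hexp h3
  set γ := ∫ ω, |Y ω| ^ 3 * Real.exp (x * |Y ω|) ∂μ with hγ
  have hγ0 : 0 ≤ γ := integral_nonneg fun ω => by positivity
  refine ⟨γ ^ ((3 : ℕ)⁻¹ : ℝ), Real.rpow_nonneg hγ0 _,
    Real.rpow_inv_natCast_pow hγ0 (by norm_num), ?_⟩
  obtain ⟨g, g0, g3, -, g2⟩ := exists_lyapunov_root hY3
  have hle : g ^ 3 ≤ γ := by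
    rw [g3]
    refine integral_mono (integrable_abs_pow_of_memLp_three hY3 le_rfl) h3 fun ω => ?_
    exact le_mul_of_one_le_right (by positivity) (Real.one_le_exp (by positivity))
  have hG3 : (γ ^ ((3 : ℕ)⁻¹ : ℝ)) ^ 3 = γ := Real.rpow_inv_natCast_pow hγ0 (by norm_num)
  have : g ≤ γ ^ ((3 : ℕ)⁻¹ : ℝ) :=
    le_of_pow_le_pow_left₀ three_ne_zero (Real.rpow_nonneg hγ0 _) (by rw [hG3]; exact hle)
  exact g2.trans (by gcongr)

theorem integral_exp_mul_bounds (hY : Measurable Y)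
    (hx : 0 ≤ x) (hexp : Integrable (fun ω => Real.exp (x * |Y ω|)) μ)
    (h3 : Integrable (fun ω => |Y ω| ^ 3 * Real.exp (x * |Y ω|)) μ) (h0 : ∫ ω, Y ω ∂μ = 0) :
    Real.exp (x ^ 2 * (∫ ω, Y ω ^ 2 ∂μ) / 2
        - 2 * (x ^ 3 * ∫ ω, |Y ω| ^ 3 * Real.exp (x * |Y ω|) ∂μ)) ≤
      ∫ ω, Real.exp (x * Y ω) ∂μ ∧
    ∫ ω, Real.exp (x * Y ω) ∂μ ≤ Real.exp (x ^ 2 * (∫ ω, Y ω ^ 2 ∂μ) / 2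
        + x ^ 3 * ∫ ω, |Y ω| ^ 3 * Real.exp (x * |Y ω|) ∂μ) := by
  obtain ⟨k0, k1, -, -⟩ := abs_expMoment_sub_le hY hx hexp h3 h0
  obtain ⟨G, G0, G3, G2⟩ := exists_root_expMoment hY hx hexp h3
  rw [← G3] at k1 ⊢
  obtain ⟨k2, k3⟩ := abs_le.1 k1
  constructor
  · exact exp_sub_le_of_expansion hx G0 (integral_nonneg fun ω => sq_nonneg _) G2 k0 (by linarith)
  · refine le_trans ?_ (Real.add_one_le_exp _)
    linarith

/-- Mean, variance and third central moment of a random variable after exponential tilting. -/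
theorem tilted_moment_bounds (hY : Measurable Y)
    (hx : 0 ≤ x) (hexp : Integrable (fun ω => Real.exp (x * |Y ω|)) μ)
    (h3 : Integrable (fun ω => |Y ω| ^ 3 * Real.exp (x * |Y ω|)) μ) (h0 : ∫ ω, Y ω ∂μ = 0)
    {ν : Measure Ω} (hν : ν = μ.tilted (fun ω => x * Y ω)) {γ m : ℝ}
    (hγ : γ = ∫ ω, |Y ω| ^ 3 * Real.exp (x * |Y ω|) ∂μ) (hm : m = ∫ ω, Y ω ∂ν) :
    IsProbabilityMeasure ν ∧ MemLp Y 3 ν ∧ |m - x * ∫ ω, Y ω ^ 2 ∂μ| ≤ 3 * (x ^ 2 * γ) ∧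
    |∫ ω, (Y ω - m) ^ 2 ∂ν - ∫ ω, Y ω ^ 2 ∂μ| ≤ 7 * (x * γ) ∧
    ∫ ω, |Y ω - m| ^ 3 ∂ν ≤ 8 * γ := by
  have hxx : |x| ≤ x := (abs_of_nonneg hx).le
  have e0 : Integrable (fun ω => Real.exp (x * Y ω)) μ := by
    simpa using integrable_abs_pow_mul_exp hY hexp h3 (k := 0) (by norm_num) hxx
  have hprob : IsProbabilityMeasure ν := hν ▸ isProbabilityMeasure_tilted e0
  have hY3 : MemLp Y 3 ν := by
    refine memLp_three_of_integrable_abs_pow hY.aestronglyMeasurable ?_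
    rw [hν, integrable_tilted_iff e0]
    simpa [mul_comm] using integrable_abs_pow_mul_exp hY hexp h3 (k := 3) le_rfl hxx
  obtain ⟨k0, k1, k2, k3⟩ := abs_expMoment_sub_le hY hx hexp h3 h0
  obtain ⟨G, G0, G3, G2⟩ := exists_root_expMoment hY hx hexp h3
  rw [← G3] at k1 k2 k3
  rw [← hγ] at G3
  rw [← G3]
  set M := ∫ ω, Real.exp (x * Y ω) ∂μ with hM
  set b := ∫ ω, Y ω ^ 2 ∂μ with hb
  have hb0 : 0 ≤ b := integral_nonneg fun ω => sq_nonneg _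
  have hMi0 : 0 ≤ M⁻¹ := inv_nonneg.2 (by linarith)
  have hMi1 : M⁻¹ ≤ 1 := inv_le_one_of_one_le₀ k0
  have hint : ∀ F : Ω → ℝ, ∫ ω, F ω ∂ν = M⁻¹ * ∫ ω, Real.exp (x * Y ω) * F ω ∂μ := by
    intro F
    rw [hν, integral_tilted, ← integral_const_mul]
    refine integral_congr_ae (ae_of_all _ fun ω => ?_)
    simp only [smul_eq_mul, ← hM]
    ring
  -- The error from the normalising factor `1 / M` of the tilted law; it enters both the mean and
  -- the second moment.
  have hkey := mul_one_sub_inv_le hx G0 hb0 G2 k0 (by linarith [(abs_le.1 k1).2])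
  have hkey0 : 0 ≤ b * (1 - M⁻¹) := mul_nonneg hb0 (by linarith)
  have hG3' : 0 ≤ x * G ^ 3 := by positivity
  have hmean : |m - x * b| ≤ 3 * (x ^ 2 * G ^ 3) := by
    rw [hm, hint]
    have e : M⁻¹ * ∫ ω, Real.exp (x * Y ω) * Y ω ∂μ - x * b
        = M⁻¹ * (∫ ω, Real.exp (x * Y ω) * Y ω ∂μ - x * b) - x * (b * (1 - M⁻¹)) := by ring
    rw [e]
    refine (abs_sub _ _).trans ?_
    rw [abs_mul, abs_of_nonneg hMi0, abs_of_nonneg (mul_nonneg hx hkey0)]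
    have := mul_le_mul hMi1 k2 (abs_nonneg _) zero_le_one
    have := mul_le_mul_of_nonneg_left hkey hx
    nlinarith
  have hsec : |∫ ω, Y ω ^ 2 ∂ν - b| ≤ 3 * (x * G ^ 3) := by
    rw [hint]
    have e : M⁻¹ * ∫ ω, Real.exp (x * Y ω) * Y ω ^ 2 ∂μ - b
        = M⁻¹ * (∫ ω, Real.exp (x * Y ω) * Y ω ^ 2 ∂μ - b) - b * (1 - M⁻¹) := by ring
    rw [e]
    refine (abs_sub _ _).trans ?_
    rw [abs_mul, abs_of_nonneg hMi0, abs_of_nonneg hkey0]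
    have := mul_le_mul hMi1 k3 (abs_nonneg _) zero_le_one
    linarith
  have hthird : ∫ ω, |Y ω| ^ 3 ∂ν ≤ G ^ 3 := by
    rw [hint, G3, hγ]
    have i3 : Integrable (fun ω => Real.exp (x * Y ω) * |Y ω| ^ 3) μ := by
      simpa [mul_comm] using integrable_abs_pow_mul_exp hY hexp h3 (k := 3) le_rfl hxx
    have h1 : ∫ ω, Real.exp (x * Y ω) * |Y ω| ^ 3 ∂μ
        ≤ ∫ ω, |Y ω| ^ 3 * Real.exp (x * |Y ω|) ∂μ := by
      refine integral_mono i3 h3 fun ω => ?_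
      simp only
      rw [mul_comm]
      have := le_abs_self (Y ω)
      gcongr
    have h2 : 0 ≤ ∫ ω, Real.exp (x * Y ω) * |Y ω| ^ 3 ∂μ := integral_nonneg fun ω => by positivity
    nlinarith
  have hmG : |m| ≤ G := by
    obtain ⟨g, g0, g3, g1, -⟩ := exists_lyapunov_root hY3
    have : g ≤ G := le_of_pow_le_pow_left₀ three_ne_zero G0 (by rw [g3]; exact hthird)
    rw [hm]
    exact (abs_integral_le_integral_abs.trans g1).trans this
  -- The variance differs from the second moment by `m²`. For `x G ≥ 1` the bound `|m| ≤ G` is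
  -- enough; for `x G ≤ 1` one factor `|m|` is bounded by `G` and the other by the expansion of the
  -- mean.
  have hmsq : m ^ 2 ≤ 4 * (x * G ^ 3) := by
    rw [← sq_abs]
    rcases le_total 1 (x * G) with h | h
    · have h1 : |m| ^ 2 ≤ G ^ 2 := by gcongr
      have h2 : G ^ 2 ≤ x * G ^ 3 := by nlinarith [sq_nonneg G]
      linarith
    · have h1 : |m| ≤ x * G ^ 2 + 3 * (x ^ 2 * G ^ 3) := by
        have h2 : |m| ≤ |m - x * b| + |x * b| := by
          have := abs_add_le (m - x * b) (x * b)
          simpa using this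
        rw [abs_of_nonneg (mul_nonneg hx hb0)] at h2
        have := mul_le_mul_of_nonneg_left G2 hx
        linarith
      have h2 : |m| ^ 2 ≤ G * (x * G ^ 2 + 3 * (x ^ 2 * G ^ 3)) := by
        rw [sq]; exact mul_le_mul hmG h1 (abs_nonneg _) G0
      have h3 : G * (x * G ^ 2 + 3 * (x ^ 2 * G ^ 3)) = (x * G ^ 3) * (1 + 3 * (x * G)) := by ring
      nlinarith
  refine ⟨hprob, hY3, hmean, ?_, ?_⟩
  · have hi2 := integrable_sq_of_memLp_three hY3
    have hi1 := integrable_of_memLp_three hY3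
    have hv : ∫ ω, (Y ω - m) ^ 2 ∂ν = ∫ ω, Y ω ^ 2 ∂ν - m ^ 2 := by
      have e : (fun ω => (Y ω - m) ^ 2) = fun ω => Y ω ^ 2 - (2 * m * Y ω - m ^ 2) := by
        funext ω; ring
      have j : Integrable (fun ω => 2 * m * Y ω - m ^ 2) ν :=
        (hi1.const_mul _).sub (integrable_const _)
      rw [e, integral_sub hi2 j, integral_sub (hi1.const_mul _) (integrable_const _),
        integral_const_mul, ← hm, integral_const, probReal_univ, one_smul]
      ring
    rw [hv]
    obtain ⟨p, q⟩ := abs_le.1 hsec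
    rw [abs_le]
    constructor <;> nlinarith [sq_nonneg m]
  · have j3 := integrable_abs_pow_of_memLp_three hY3 (k := 3) le_rfl
    have hsub : MemLp (fun ω => Y ω - m) 3 ν := hY3.sub (memLp_const m)
    have h1 : ∫ ω, |Y ω - m| ^ 3 ∂ν ≤ ∫ ω, (4 * |Y ω| ^ 3 + 4 * |m| ^ 3) ∂ν := by
      refine integral_mono (integrable_abs_pow_of_memLp_three hsub le_rfl)
        ((j3.const_mul _).add (integrable_const _)) fun ω => ?_
      have h2 : |Y ω - m| ^ 3 ≤ (|Y ω| + |m|) ^ 3 :=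
        pow_le_pow_left₀ (abs_nonneg _) (abs_sub _ _) 3
      simp only
      nlinarith [mul_nonneg (add_nonneg (abs_nonneg (Y ω)) (abs_nonneg m))
        (sq_nonneg (|Y ω| - |m|))]
    rw [integral_add (j3.const_mul _) (integrable_const _), integral_const_mul, integral_const,
      probReal_univ, one_smul] at h1
    have h2 : |m| ^ 3 ≤ G ^ 3 := by gcongr
    linarith

end OneVariable

/-! ### Tilting an independent family along its sum. -/

section Tilting

variable {Ω : Type*} [MeasurableSpace Ω] {μ : Measure Ω}
  {ι : Type*} [Fintype ι] {X : ι → Ω → ℝ} {x : ℝ}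

theorem integral_exp_mul_sum (hm : ∀ i, Measurable (X i)) (hind : iIndepFun X μ) (x : ℝ) :
    ∫ ω, Real.exp (x * ∑ i, X i ω) ∂μ = ∏ i, ∫ ω, Real.exp (x * X i ω) ∂μ := by
  have := hind.mgf_sum (t := x) hm Finset.univ
  simpa [mgf, Finset.sum_apply] using this

variable [IsProbabilityMeasure μ]

/-- Exponential tilting in the direction of the sum acts on independent variables one by one. -/
theorem map_tilted_mul_sum (hm : ∀ i, Measurable (X i)) (hind : iIndepFun X μ)
    (hexp : ∀ i, Integrable (fun ω => Real.exp (x * X i ω)) μ) :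
    (μ.tilted (fun ω => x * ∑ i, X i ω)).map (fun ω i => X i ω) =
      Measure.pi fun i => (μ.tilted (fun ω => x * X i ω)).map (X i) := by
  have hp : ∀ i, IsProbabilityMeasure ((μ.tilted (fun ω => x * X i ω)).map (X i)) := fun i => by
    have := isProbabilityMeasure_tilted (hexp i)
    exact Measure.isProbabilityMeasure_map (hm i).aemeasurable
  refine (Measure.pi_eq fun s hs => ?_).symm
  have hXm : Measurable fun ω i => X i ω := measurable_pi_lambda _ hm
  have hpre : MeasurableSet ((fun ω i => X i ω) ⁻¹' Set.univ.pi s) :=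
    hXm (MeasurableSet.univ_pi hs)
  rw [Measure.map_apply hXm (MeasurableSet.univ_pi hs), tilted_apply' _ _ hpre,
    ← lintegral_indicator hpre]
  -- Both the exponential of the sum and its normalising constant factorise, so on a box the tilted
  -- density is a product of functions of the single variables.
  set φ : ι → ℝ → ℝ≥0∞ := fun i => Set.indicator (s i) fun y =>
    ENNReal.ofReal (Real.exp (x * y) / ∫ ω, Real.exp (x * X i ω) ∂μ) with hφ
  have hφm : ∀ i, Measurable (φ i) := fun i => Measurable.indicator (by fun_prop) (hs i)
  have hterm : ∀ i, (μ.tilted (fun ω => x * X i ω)).map (X i) (s i)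
      = ∫⁻ ω, φ i (X i ω) ∂μ := fun i => by
    rw [Measure.map_apply (hm i) (hs i), tilted_apply' _ _ (hm i (hs i)),
      ← lintegral_indicator (hm i (hs i))]
    rfl
  have hprod := lintegral_prod_eq_prod_lintegral_of_indepFun Finset.univ
    (fun i ω => φ i (X i ω)) (hind.comp φ hφm) fun i => (hφm i).comp (hm i)
  rw [Finset.prod_congr rfl fun i _ => hterm i, ← hprod]
  refine lintegral_congr fun ω => ?_
  by_cases hω : ω ∈ (fun ω i => X i ω) ⁻¹' Set.univ.pi s
  · have hωi : ∀ i, X i ω ∈ s i := fun i => hω i (Set.mem_univ i)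
    rw [Set.indicator_of_mem hω, integral_exp_mul_sum hm hind]
    have : ∀ i, φ i (X i ω)
        = ENNReal.ofReal (Real.exp (x * X i ω) / ∫ ω, Real.exp (x * X i ω) ∂μ) := fun i =>
      Set.indicator_of_mem (hωi i) _
    rw [Finset.prod_congr rfl fun i _ => this i, ← ENNReal.ofReal_prod_of_nonneg
      fun i _ => div_nonneg (Real.exp_pos _).le (integral_nonneg fun _ => (Real.exp_pos _).le),
      Finset.prod_div_distrib, ← Real.exp_sum, Finset.mul_sum]
  · rw [Set.indicator_of_notMem hω]
    obtain ⟨i, hi⟩ : ∃ i, X i ω ∉ s i := by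
      by_contra! h
      exact hω fun i _ => h i
    exact (Finset.prod_eq_zero (Finset.mem_univ i) (Set.indicator_of_notMem hi _)).symm

theorem integrable_exp_mul_sum (hm : ∀ i, Measurable (X i)) (hind : iIndepFun X μ)
    (hexp : ∀ i, Integrable (fun ω => Real.exp (x * X i ω)) μ) :
    Integrable (fun ω => Real.exp (x * ∑ i, X i ω)) μ := by
  have := hind.integrable_exp_mul_sum hm (s := Finset.univ) (t := x) fun i _ => hexp i
  simpa [Finset.sum_apply] using this

theorem identDistrib_tilted (hm : ∀ i, Measurable (X i)) (hind : iIndepFun X μ)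
    (hexp : ∀ i, Integrable (fun ω => Real.exp (x * X i ω)) μ) (i : ι) :
    IdentDistrib (X i) (X i) (μ.tilted (fun ω => x * ∑ i, X i ω))
      (μ.tilted (fun ω => x * X i ω)) := by
  have hp : ∀ i, IsProbabilityMeasure ((μ.tilted (fun ω => x * X i ω)).map (X i)) := fun i => by
    have := isProbabilityMeasure_tilted (hexp i)
    exact Measure.isProbabilityMeasure_map (hm i).aemeasurable
  refine ⟨(hm i).aemeasurable, (hm i).aemeasurable, ?_⟩
  have h1 := (measurePreserving_eval
    (fun i => (μ.tilted (fun ω => x * X i ω)).map (X i)) i).map_eq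
  rw [← map_tilted_mul_sum hm hind hexp,
    Measure.map_map (measurable_pi_apply i) (measurable_pi_lambda _ hm)] at h1
  exact h1

theorem iIndepFun_tilted (hm : ∀ i, Measurable (X i)) (hind : iIndepFun X μ)
    (hexp : ∀ i, Integrable (fun ω => Real.exp (x * X i ω)) μ) :
    iIndepFun X (μ.tilted (fun ω => x * ∑ i, X i ω)) := by
  have := isProbabilityMeasure_tilted (integrable_exp_mul_sum hm hind hexp)
  rw [iIndepFun_iff_map_fun_eq_pi_map fun i => (hm i).aemeasurable,
    map_tilted_mul_sum hm hind hexp]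
  congr 1
  funext i
  exact (identDistrib_tilted hm hind hexp i).map_eq.symm

/-- Normal approximation for the tilted law of the sum. -/
theorem abs_tilted_sum_lt_sub_stdNormalCdf_le (hm : ∀ i, Measurable (X i)) (hind : iIndepFun X μ)
    (hx : 0 ≤ x) (hexp : ∀ i, Integrable (fun ω => Real.exp (x * |X i ω|)) μ)
    (h3 : ∀ i, Integrable (fun ω => |X i ω| ^ 3 * Real.exp (x * |X i ω|)) μ)
    (h0 : ∀ i, ∫ ω, X i ω ∂μ = 0) (h1 : ∑ i, ∫ ω, X i ω ^ 2 ∂μ = 1) {γ : ℝ}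
    (hγ : γ = ∑ i, ∫ ω, |X i ω| ^ 3 * Real.exp (x * |X i ω|) ∂μ) (hγ0 : 0 < γ) (z : ℝ) :
    |(μ.tilted (fun ω => x * ∑ i, X i ω)).real {ω | ∑ i, X i ω < z} - stdNormalCdf (z - x)| ≤
      2000 * ((1 + x ^ 2) * γ) := by
  have hxx : |x| ≤ x := (abs_of_nonneg hx).le
  have e0 : ∀ i, Integrable (fun ω => Real.exp (x * X i ω)) μ := fun i => by
    simpa using integrable_abs_pow_mul_exp (hm i) (hexp i) (h3 i) (k := 0) (by norm_num) hxx
  set P := μ.tilted (fun ω => x * ∑ i, X i ω) with hP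
  have hPp : IsProbabilityMeasure P :=
    isProbabilityMeasure_tilted (integrable_exp_mul_sum hm hind e0)
  have hPind : iIndepFun X P := iIndepFun_tilted hm hind e0
  have hid := identDistrib_tilted hm hind e0
  set m : ι → ℝ := fun i => ∫ ω, X i ω ∂(μ.tilted (fun ω => x * X i ω)) with hmdef
  have hb := fun i => tilted_moment_bounds (hm i) hx (hexp i) (h3 i) (h0 i) rfl rfl
    (show m i = _ from rfl)
  set Z : ι → Ω → ℝ := fun i ω => X i ω - m i with hZ
  have hZm : ∀ i, Measurable (Z i) := fun i => (hm i).sub_const _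
  have hZind : iIndepFun Z P := hPind.comp (fun i y => y - m i) fun i => by fun_prop
  have hX3 : ∀ i, MemLp (X i) 3 P := fun i => (hid i).memLp_iff.2 (hb i).2.1
  have hZ3 : ∀ i, MemLp (Z i) 3 P := fun i => (hX3 i).sub (memLp_const (m i))
  have hXP : ∀ i, ∫ ω, X i ω ∂P = m i := fun i => (hid i).integral_eq
  have hZ0 : ∀ i, ∫ ω, Z i ω ∂P = 0 := fun i => by
    rw [hZ]; simp only
    rw [integral_sub (integrable_of_memLp_three (hX3 i)) (integrable_const _), hXP, integral_const,
      probReal_univ, one_smul, sub_self]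
  have hZsq : ∀ i, ∫ ω, Z i ω ^ 2 ∂P
      = ∫ ω, (X i ω - m i) ^ 2 ∂(μ.tilted (fun ω => x * X i ω)) := fun i =>
    ((hid i).comp (u := fun y => (y - m i) ^ 2) (by fun_prop)).integral_eq
  have hZcube : ∀ i, ∫ ω, |Z i ω| ^ 3 ∂P
      = ∫ ω, |X i ω - m i| ^ 3 ∂(μ.tilted (fun ω => x * X i ω)) := fun i =>
    ((hid i).comp (u := fun y => |y - m i| ^ 3) (by fun_prop)).integral_eq
  have hβ : ∑ i, ∫ ω, |Z i ω| ^ 3 ∂P ≤ 8 * γ := by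
    rw [hγ, Finset.mul_sum]
    refine Finset.sum_le_sum fun i _ => ?_
    rw [hZcube]; exact (hb i).2.2.2.2
  have hB : |∑ i, ∫ ω, Z i ω ^ 2 ∂P - 1| ≤ 7 * (x * γ) := by
    rw [← h1, ← Finset.sum_sub_distrib, hγ, Finset.mul_sum, Finset.mul_sum]
    refine (Finset.abs_sum_le_sum_abs _ _).trans (Finset.sum_le_sum fun i _ => ?_)
    rw [hZsq]; exact (hb i).2.2.2.1
  have hmean : |∑ i, m i - x| ≤ 3 * (x ^ 2 * γ) := by
    rw [show x = x * ∑ i, ∫ ω, X i ω ^ 2 ∂μ by rw [h1, mul_one], Finset.mul_sum,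
      ← Finset.sum_sub_distrib, ← Finset.mul_sum, h1, mul_one, hγ, Finset.mul_sum, Finset.mul_sum]
    exact (Finset.abs_sum_le_sum_abs _ _).trans (Finset.sum_le_sum fun i _ => (hb i).2.2.1)
  have hBE := abs_measureReal_sum_lt_sub_stdNormalCdf_le hZm hZind hZ3 hZ0
    (by positivity : 0 < 8 * γ) hβ (z - ∑ i, m i)
  have hset : {ω | ∑ i, Z i ω < z - ∑ i, m i} = {ω | ∑ i, X i ω < z} := by
    ext ω
    simp only [hZ, Finset.sum_sub_distrib, Set.mem_ofPred_eq, sub_lt_sub_iff_right]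
  rw [hset] at hBE
  have hshift := abs_stdNormalCdf_sub_le (z - ∑ i, m i) (z - x)
  have : |z - ∑ i, m i - (z - x)| ≤ 3 * (x ^ 2 * γ) := by
    rw [abs_sub_comm]; convert hmean using 2; ring
  have htri := abs_sub_le (P.real {ω | ∑ i, X i ω < z}) (stdNormalCdf (z - ∑ i, m i))
    (stdNormalCdf (z - x))
  -- The total error is `140 (8 γ + 7 x γ) + 3 x² γ`; this removes the term linear in `x`.
  have hx2 : x * γ ≤ (1 + x ^ 2) / 2 * γ := by
    gcongr; nlinarith [sq_nonneg (x - 1)]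
  nlinarith [mul_nonneg (sq_nonneg x) hγ0.le]

end Tilting

/-! ### The exponential tail functional. -/

theorem measureReal_gaussianReal_Iio (z : ℝ) :
    (gaussianReal 0 1).real (Set.Iio z) = stdNormalCdf z := by
  rw [gaussianReal_real_eq, stdNormalCdf_eq_integral, integral_Iic_eq_integral_Iio]

/-- The function `u ↦ exp (-x u)` on the half line `[0, ∞)`, extended by zero. -/
noncomputable def expTail (x : ℝ) : ℝ → ℝ := Set.indicator (Set.Ici 0) fun u => Real.exp (-(x * u))

theorem measurable_expTail (x : ℝ) : Measurable (expTail x) :=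
  Measurable.indicator (by fun_prop) measurableSet_Ici

theorem expTail_nonneg (x u : ℝ) : 0 ≤ expTail x u :=
  Set.indicator_nonneg (fun _ _ => (Real.exp_pos _).le) _

theorem expTail_le_one {x : ℝ} (hx : 0 ≤ x) (u : ℝ) : expTail x u ≤ 1 := by
  refine Set.indicator_le' (fun u hu => ?_) (fun _ _ => zero_le_one) u
  rw [Real.exp_le_one_iff, neg_nonpos]
  exact mul_nonneg hx hu

/-- Completing the square: `exp (-x u) φ(u) = exp (x²/2) φ(u + x)`. -/
theorem integral_expTail_gaussianReal (x : ℝ) :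
    ∫ u, expTail x u ∂(gaussianReal 0 1) = Real.exp (x ^ 2 / 2) * (1 - stdNormalCdf x) := by
  rw [integral_gaussianReal_eq_integral_smul one_ne_zero, one_sub_stdNormalCdf,
    ← integral_Ici_eq_integral_Ioi, ← integral_indicator measurableSet_Ici,
    ← integral_add_right_eq_self (Set.indicator (Set.Ici x) fun u => stdNormalPdf u) x,
    ← integral_const_mul]
  refine integral_congr_ae (ae_of_all _ fun u => ?_)
  change stdNormalPdf u • expTail x u
    = Real.exp (x ^ 2 / 2) * (Set.Ici x).indicator (fun u => stdNormalPdf u) (u + x)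
  by_cases hu : u ∈ Set.Ici (0 : ℝ)
  · have hu' : u + x ∈ Set.Ici x := by simpa using hu
    rw [expTail, Set.indicator_of_mem hu, Set.indicator_of_mem hu', stdNormalPdf_eq,
      stdNormalPdf_eq, smul_eq_mul, mul_assoc, ← Real.exp_add, mul_left_comm, ← Real.exp_add]
    congr 2
    ring
  · have hu' : u + x ∉ Set.Ici x := by simpa using hu
    rw [expTail, Set.indicator_of_notMem hu, Set.indicator_of_notMem hu', smul_zero, mul_zero]

/-- Superlevel sets are differences of at most two half lines, so their probabilities are compared
by at most two values of the distribution functions. The unbounded case arises from `x = 0`. -/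
theorem setOf_lt_expTail {x t : ℝ} (hx : 0 ≤ x) (ht : 0 < t) :
    {u | t < expTail x u} = ∅ ∨ {u | t < expTail x u} = (Set.Iio 0)ᶜ ∨
      ∃ c, 0 ≤ c ∧ {u | t < expTail x u} = Set.Iio c \ Set.Iio 0 := by
  have hneg : ∀ u < 0, ¬ t < expTail x u := fun u hu => by
    rw [expTail, Set.indicator_of_notMem (by simpa using hu)]; exact not_lt.2 ht.le
  have hpos : ∀ u, 0 ≤ u → expTail x u = Real.exp (-(x * u)) := fun u hu =>
    Set.indicator_of_mem (by simpa using hu) _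
  rcases le_or_gt 1 t with h1 | h1
  · left
    ext u
    simpa using (expTail_le_one hx u).trans h1
  rcases hx.eq_or_lt with rfl | hx
  · right; left
    ext u
    rcases lt_or_ge u 0 with hu | hu
    · simp [hneg u hu, hu]
    · simp [hpos u hu, hu, h1]
  · right; right
    refine ⟨-Real.log t / x, div_nonneg (neg_nonneg.2 (Real.log_nonpos ht.le h1.le)) hx.le, ?_⟩
    ext u
    rcases lt_or_ge u 0 with hu | hu
    · simp [hneg u hu, hu]
    · simp only [Set.mem_ofPred_eq, hpos u hu, Set.mem_sdiff, Set.mem_Iio, not_lt, hu, and_true]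
      rw [← Real.log_lt_iff_lt_exp ht, lt_div_iff₀ hx]
      constructor <;> intro h <;> linarith

/-- Integrals of `expTail` against two laws are close when the distribution functions are. -/
theorem abs_integral_expTail_sub_le {ν₁ ν₂ : Measure ℝ} [IsProbabilityMeasure ν₁]
    [IsProbabilityMeasure ν₂] {ε x : ℝ} (hx : 0 ≤ x)
    (h : ∀ z, |ν₁.real (Set.Iio z) - ν₂.real (Set.Iio z)| ≤ ε) :
    |∫ u, expTail x u ∂ν₁ - ∫ u, expTail x u ∂ν₂| ≤ 2 * ε := by
  have hε : 0 ≤ ε := (abs_nonneg _).trans (h 0)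
  have hanti : ∀ ν : Measure ℝ, IsProbabilityMeasure ν →
      Antitone fun t => ν.real {u | t < expTail x u} := fun ν _ s t hst =>
    measureReal_mono fun u (hu : t < expTail x u) => hst.trans_lt hu
  have hint : ∀ ν : Measure ℝ, IsProbabilityMeasure ν →
      IntegrableOn (fun t => ν.real {u | t < expTail x u}) (Set.Ioc 0 1) := fun ν hν =>
    Integrable.of_bound (hanti ν hν).measurable.aestronglyMeasurable 1 (ae_of_all _ fun t => by
      rw [Real.norm_eq_abs, abs_of_nonneg measureReal_nonneg]; exact measureReal_le_one)
  have hlayer : ∀ ν : Measure ℝ, IsProbabilityMeasure ν →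
      ∫ u, expTail x u ∂ν = ∫ t in Set.Ioc 0 1, ν.real {u | t < expTail x u} := fun ν _ => by
    have hi : Integrable (expTail x) ν :=
      Integrable.of_bound (measurable_expTail x).aestronglyMeasurable 1 (ae_of_all _ fun u => by
        rw [Real.norm_eq_abs, abs_of_nonneg (expTail_nonneg x u)]; exact expTail_le_one hx u)
    rw [hi.integral_eq_integral_meas_lt (ae_of_all _ fun u => expTail_nonneg x u)]
    refine setIntegral_eq_of_subset_of_forall_sdiff_eq_zero measurableSet_Ioi
      Set.Ioc_subset_Ioi_self fun t ht => ?_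
    have ht1 : 1 < t := by
      by_contra! hc
      exact ht.2 ⟨ht.1, hc⟩
    have : {u | t < expTail x u} = ∅ := by
      ext u
      simpa using (expTail_le_one hx u).trans ht1.le
    rw [this]; simp
  rw [hlayer ν₁ inferInstance, hlayer ν₂ inferInstance,
    ← integral_sub (hint ν₁ inferInstance) (hint ν₂ inferInstance)]
  have := norm_setIntegral_le_of_norm_le_const (μ := volume) (s := Set.Ioc (0 : ℝ) 1) (C := 2 * ε)
    (f := fun t => ν₁.real {u | t < expTail x u} - ν₂.real {u | t < expTail x u}) (by simp)
    fun t ht => ?_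
  · simpa using this
  · rw [Real.norm_eq_abs]
    rcases setOf_lt_expTail hx ht.1 with e | e | ⟨c, hc, e⟩ <;> rw [e]
    · simpa using hε
    · rw [probReal_compl_eq_one_sub measurableSet_Iio, probReal_compl_eq_one_sub measurableSet_Iio]
      have := h 0
      rw [abs_sub_comm] at this
      rw [show ∀ a b : ℝ, 1 - a - (1 - b) = b - a by intros; ring]
      linarith
    · have hsub : Set.Iio (0 : ℝ) ⊆ Set.Iio c := Set.Iio_subset_Iio hc
      rw [measureReal_sdiff hsub measurableSet_Iio, measureReal_sdiff hsub measurableSet_Iio]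
      rw [show ∀ a b c d : ℝ, a - b - (c - d) = (a - c) - (b - d) by intros; ring]
      refine (abs_sub _ _).trans ?_
      linarith [h c, h 0]

/-! ### Undoing the tilt: the moderate deviation bound. -/

section ModerateDeviation

variable {Ω : Type*} [MeasurableSpace Ω] {μ : Measure Ω} [IsProbabilityMeasure μ]

theorem measureReal_le_eq_integral_tilted {W : Ω → ℝ} (hW : Measurable W) {x : ℝ}
    (hexp : Integrable (fun ω => Real.exp (x * W ω)) μ) :
    μ.real {ω | x ≤ W ω} = (∫ ω, Real.exp (x * W ω) ∂μ) * Real.exp (-x ^ 2) *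
      ∫ ω, expTail x (W ω - x) ∂(μ.tilted fun ω => x * W ω) := by
  have hM : 0 < ∫ ω, Real.exp (x * W ω) ∂μ := integral_exp_pos hexp
  have hS : MeasurableSet {ω | x ≤ W ω} := measurableSet_le measurable_const hW
  rw [integral_tilted, ← integral_const_mul, ← integral_indicator_one hS]
  refine integral_congr_ae (ae_of_all _ fun ω => ?_)
  simp only [smul_eq_mul]
  by_cases hω : x ≤ W ω
  · have h1 : W ω - x ∈ Set.Ici (0 : ℝ) := by simpa using hω
    rw [Set.indicator_of_mem (show ω ∈ {ω | x ≤ W ω} from hω), expTail, Set.indicator_of_mem h1,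
      Pi.one_apply]
    have : Real.exp (-x ^ 2) * Real.exp (x * W ω) * Real.exp (-(x * (W ω - x))) = 1 := by
      rw [← Real.exp_add, ← Real.exp_add, Real.exp_eq_one_iff]; ring
    field_simp
    linarith
  · have h1 : W ω - x ∉ Set.Ici (0 : ℝ) := by simpa using hω
    rw [Set.indicator_of_notMem (show ω ∉ {ω | x ≤ W ω} from hω), expTail,
      Set.indicator_of_notMem h1, mul_zero, mul_zero]

/-- **Cramér-type moderate deviation theorem**, for real-valued `γ`. -/
theorem abs_measureReal_div_sub_one_le {ι : Type*} [Fintype ι] {X : ι → Ω → ℝ} {x : ℝ}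
    (hm : ∀ i, Measurable (X i)) (hind : iIndepFun X μ)
    (hx : 0 ≤ x) (hexp : ∀ i, Integrable (fun ω => Real.exp (x * |X i ω|)) μ)
    (h3 : ∀ i, Integrable (fun ω => |X i ω| ^ 3 * Real.exp (x * |X i ω|)) μ)
    (h0 : ∀ i, ∫ ω, X i ω ∂μ = 0) (h1 : ∑ i, ∫ ω, X i ω ^ 2 ∂μ = 1) {γ : ℝ}
    (hγ : γ = ∑ i, ∫ ω, |X i ω| ^ 3 * Real.exp (x * |X i ω|) ∂μ) :
    |μ.real {ω | x ≤ ∑ i, X i ω} / (1 - stdNormalCdf x) - 1| ≤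
      200000 * ((1 + x ^ 3) * γ * Real.exp (4 * x ^ 3 * γ)) := by
  have hγi : ∀ i, 0 ≤ ∫ ω, |X i ω| ^ 3 * Real.exp (x * |X i ω|) ∂μ := fun i =>
    integral_nonneg fun ω => by positivity
  -- The normal approximation needs `γ > 0`. If `γ` vanished, so would all variances by Lyapunov,
  -- against total variance one.
  have hγ0 : 0 < γ := by
    rw [hγ]
    refine (Finset.sum_nonneg fun i _ => hγi i).lt_of_ne fun hz => ?_
    have hz' := (Finset.sum_eq_zero_iff_of_nonneg fun i _ => hγi i).1 hz.symm
    have : ∑ i, ∫ ω, X i ω ^ 2 ∂μ ≤ 0 := Finset.sum_nonpos fun i hi => by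
      obtain ⟨G, -, G3, G2⟩ := exists_root_expMoment (hm i) hx (hexp i) (h3 i)
      rw [hz' i hi] at G3
      have : G = 0 := by simpa using G3
      simpa [this] using G2
    linarith
  have hxx : |x| ≤ x := (abs_of_nonneg hx).le
  have e0 : ∀ i, Integrable (fun ω => Real.exp (x * X i ω)) μ := fun i => by
    simpa using integrable_abs_pow_mul_exp (hm i) (hexp i) (h3 i) (k := 0) (by norm_num) hxx
  set W : Ω → ℝ := fun ω => ∑ i, X i ω with hW
  have hWm : Measurable W := Finset.measurable_fun_sum _ fun i _ => hm i
  have hWexp : Integrable (fun ω => Real.exp (x * W ω)) μ := integrable_exp_mul_sum hm hind e0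
  have hPp : IsProbabilityMeasure (μ.tilted fun ω => x * W ω) :=
    isProbabilityMeasure_tilted hWexp
  set ε : ℝ := 2000 * ((1 + x ^ 2) * γ) with hε
  set T : ℝ := 1 - stdNormalCdf x with hT
  set M : ℝ := ∫ ω, Real.exp (x * W ω) ∂μ with hM
  set I : ℝ := ∫ ω, expTail x (W ω - x) ∂(μ.tilted fun ω => x * W ω) with hI
  have hprob : μ.real {ω | x ≤ W ω} = M * Real.exp (-x ^ 2) * I :=
    measureReal_le_eq_integral_tilted hWm hWexp
  have hI' : |I - Real.exp (x ^ 2 / 2) * T| ≤ 2 * ε := by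
    have hshift : Measurable fun ω => W ω - x := hWm.sub_const x
    have : IsProbabilityMeasure ((μ.tilted fun ω => x * W ω).map fun ω => W ω - x) :=
      Measure.isProbabilityMeasure_map hshift.aemeasurable
    rw [hI, ← integral_expTail_gaussianReal, ← integral_map (f := expTail x)
      hshift.aemeasurable (measurable_expTail x).aestronglyMeasurable]
    refine abs_integral_expTail_sub_le hx fun z => ?_
    rw [measureReal_gaussianReal_Iio, map_measureReal_apply hshift measurableSet_Iio]
    have := abs_tilted_sum_lt_sub_stdNormalCdf_le hm hind hx hexp h3 h0 h1 hγ hγ0 (z + x)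
    rw [add_sub_cancel_right] at this
    convert this using 5
    ext ω
    simp [hW, sub_lt_iff_lt_add]
  have hmgf := fun i => integral_exp_mul_bounds (hm i) hx (hexp i) (h3 i) (h0 i)
  have hMprod : M = ∏ i, ∫ ω, Real.exp (x * X i ω) ∂μ := integral_exp_mul_sum hm hind x
  set y : ℝ := x ^ 3 * γ with hy
  have hy0 : 0 ≤ y := by positivity
  have hMup : M ≤ Real.exp (x ^ 2 / 2 + y) := by
    rw [hMprod]
    refine (Finset.prod_le_prod (fun i _ => integral_nonneg fun _ => (Real.exp_pos _).le)
      fun i _ => (hmgf i).2).trans_eq ?_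
    rw [← Real.exp_sum, Finset.sum_add_distrib, ← Finset.sum_div, ← Finset.mul_sum,
      ← Finset.mul_sum, h1, ← hγ, mul_one]
  have hMlo : Real.exp (x ^ 2 / 2 - 2 * y) ≤ M := by
    rw [hMprod]
    refine Eq.trans_le ?_ (Finset.prod_le_prod (fun i _ => (Real.exp_pos _).le)
      fun i _ => (hmgf i).1)
    rw [← Real.exp_sum, Finset.sum_sub_distrib, ← Finset.sum_div, ← Finset.mul_sum,
      ← Finset.mul_sum, ← Finset.mul_sum, h1, ← hγ, mul_one]
  -- Splitting `exp (-x²)` into two halves writes the ratio as `A * J`: `A` compares the generating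
  -- function with the Gaussian one, `J` compares the tail functional with its Gaussian value. Both
  -- are close to one.
  set A : ℝ := M * Real.exp (-x ^ 2 / 2) with hA
  have hA0 : 0 ≤ A := mul_nonneg ((Real.exp_pos _).le.trans hMlo) (Real.exp_pos _).le
  have hAup : A ≤ Real.exp y := by
    calc A ≤ Real.exp (x ^ 2 / 2 + y) * Real.exp (-x ^ 2 / 2) :=
          mul_le_mul_of_nonneg_right hMup (Real.exp_pos _).le
      _ = Real.exp y := by rw [← Real.exp_add]; congr 1; ring
  have hAlo : Real.exp (-(2 * y)) ≤ A := by
    calc Real.exp (-(2 * y)) = Real.exp (x ^ 2 / 2 - 2 * y) * Real.exp (-x ^ 2 / 2) := by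
          rw [← Real.exp_add]; congr 1; ring
      _ ≤ A := mul_le_mul_of_nonneg_right hMlo (Real.exp_pos _).le
  have hE1 : 1 ≤ Real.exp y := Real.one_le_exp hy0
  have hA1 : |A - 1| ≤ 2 * y * Real.exp y := by
    rw [abs_le]
    constructor
    · have := Real.add_one_le_exp (-(2 * y))
      nlinarith
    · have h2 := Real.add_one_le_exp (-y)
      have h4 : Real.exp y * Real.exp (-y) = 1 := by rw [← Real.exp_add]; simp
      nlinarith
  have hmills := exp_neg_sq_div_le_one_sub_stdNormalCdf hx
  have hT0 : 0 < T := by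
    have : 0 < 15 * (1 + x) * T := (Real.exp_pos _).trans_le hmills
    exact pos_of_mul_pos_right this (by positivity)
  set J : ℝ := I * Real.exp (-x ^ 2 / 2) / T with hJ
  -- The absolute error `2 ε` is multiplied by `exp (-x²/2) / T`, at most `15 (1 + x)` by Mills'
  -- ratio.
  have hJ1 : |J - 1| ≤ 30 * ((1 + x) * ε) := by
    have e : J - 1 = (I - Real.exp (x ^ 2 / 2) * T) * Real.exp (-x ^ 2 / 2) / T := by
      have : Real.exp (x ^ 2 / 2) * Real.exp (-x ^ 2 / 2) = 1 := by
        rw [← Real.exp_add, Real.exp_eq_one_iff]; ring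
      rw [hJ, eq_div_iff hT0.ne', sub_mul, div_mul_cancel₀ _ hT0.ne']
      linear_combination T * this
    rw [e, abs_div, abs_mul, abs_of_pos hT0, abs_of_pos (Real.exp_pos _), div_le_iff₀ hT0]
    calc _ ≤ (2 * ε) * (15 * (1 + x) * T) :=
          mul_le_mul hI' hmills (Real.exp_pos _).le (by positivity)
      _ = _ := by ring
  have hR : μ.real {ω | x ≤ W ω} / T = A * J := by
    have hsplit : Real.exp (-x ^ 2) = Real.exp (-x ^ 2 / 2) * Real.exp (-x ^ 2 / 2) := by
      rw [← Real.exp_add, add_halves]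
    rw [hprob, hA, hJ, hsplit]
    ring
  have hfin : |A * J - 1| ≤ Real.exp y * (30 * ((1 + x) * ε)) + 2 * y * Real.exp y := by
    rw [show A * J - 1 = A * (J - 1) + (A - 1) by ring]
    refine (abs_add_le _ _).trans (add_le_add ?_ hA1)
    rw [abs_mul, abs_of_nonneg hA0]
    exact mul_le_mul hAup hJ1 (abs_nonneg _) (Real.exp_pos _).le
  rw [hR]
  -- The argument yields the smaller factor `exp (x³ γ)`; the coefficient `4` is slack.
  have hexp4 : Real.exp y ≤ Real.exp (4 * x ^ 3 * γ) := Real.exp_le_exp.2 (by linarith)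
  have hpoly : 30 * ((1 + x) * ε) + 2 * y ≤ 200000 * ((1 + x ^ 3) * γ) := by
    have h2 : (1 + x) * (1 + x ^ 2) ≤ 3 * (1 + x ^ 3) := by
      nlinarith [mul_nonneg (add_nonneg hx zero_le_one) (sq_nonneg (x - 1))]
    have h4 := mul_le_mul_of_nonneg_right h2 hγ0.le
    rw [hε, hy]
    nlinarith
  calc |A * J - 1| ≤ (30 * ((1 + x) * ε) + 2 * y) * Real.exp y := by linarith
    _ ≤ (200000 * ((1 + x ^ 3) * γ)) * Real.exp (4 * x ^ 3 * γ) := by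
        have : 0 ≤ ε := by positivity
        gcongr
    _ = _ := by ring

end ModerateDeviation

/-- The gap `t - x > 0` absorbs the cubic factor, by `v³ / 6 ≤ exp v` with `v = (t - x) |Y|`. -/
theorem lintegral_abs_pow_three_mul_exp_lt_top {Ω : Type*} [MeasurableSpace Ω] {μ : Measure Ω}
    {Y : Ω → ℝ} (hY : Measurable Y) {x t : ℝ} (hxt : x < t)
    (hexp : Integrable (fun ω => Real.exp (t * |Y ω|)) μ) :
    ∫⁻ ω, ENNReal.ofReal (|Y ω| ^ 3 * Real.exp (x * |Y ω|)) ∂μ < ∞ := by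
  have hd : 0 < t - x := sub_pos.2 hxt
  refine Integrable.lintegral_lt_top ((hexp.const_mul (6 / (t - x) ^ 3)).mono' (by fun_prop)
    (ae_of_all _ fun ω => ?_))
  have h1 := Real.pow_div_factorial_le_exp ((t - x) * |Y ω|)
    (mul_nonneg hd.le (abs_nonneg _)) 3
  rw [show ((Nat.factorial 3 : ℕ) : ℝ) = 6 by norm_num [Nat.factorial],
    div_le_iff₀ (by norm_num), mul_pow] at h1
  rw [Real.norm_eq_abs, abs_of_nonneg (by positivity)]
  have h2 : Real.exp (t * |Y ω|) = Real.exp ((t - x) * |Y ω|) * Real.exp (x * |Y ω|) := by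
    rw [← Real.exp_add]; congr 1; ring
  rw [h2, ← mul_assoc]
  gcongr
  rw [div_mul_eq_mul_div, le_div_iff₀ (by positivity)]
  linarith

theorem proposition4p5 :
    ∃ C : ℝ, 0 < C ∧
      ∀ {Ω : Type*} [MeasurableSpace Ω] (μ : Measure Ω) [IsProbabilityMeasure μ]
        (n : ℕ) (ξ : Fin n → Ω → ℝ) (t : ℝ),
        (∀ i, Measurable (ξ i)) →
        iIndepFun ξ μ →
        (∀ i, MemLp (ξ i) 2 μ) →
        (∀ i, ∫ ω, ξ i ω ∂μ = 0) →
        (∀ i, Integrable (fun ω => Real.exp (t * |ξ i ω|)) μ) →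
        ∑ i, ∫ ω, ξ i ω ^ 2 ∂μ = 1 →
        ∀ x : ℝ, 0 ≤ x → x ≤ t →
          (x < t → cramerGamma μ ξ x < ∞) ∧
          (cramerGamma μ ξ x < ∞ →
            |μ.real {ω | x ≤ ∑ i, ξ i ω} / (1 - stdNormalCdf x) - 1| ≤
              C * ((1 + x ^ 3) * (cramerGamma μ ξ x).toReal *
                Real.exp (4 * x ^ 3 * (cramerGamma μ ξ x).toReal))) := by
  refine ⟨200000, by norm_num, ?_⟩
  intro Ω _ μ _ n ξ t hm hind _ h0 hexp h1 x hx hxt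
  refine ⟨fun hlt => ENNReal.sum_lt_top.2 fun i _ =>
    lintegral_abs_pow_three_mul_exp_lt_top (hm i) hlt (hexp i), fun hfin => ?_⟩
  have hfi : ∀ i, ∫⁻ ω, ENNReal.ofReal (|ξ i ω| ^ 3 * Real.exp (x * |ξ i ω|)) ∂μ < ∞ := fun i =>
    ENNReal.sum_lt_top.1 hfin i (Finset.mem_univ i)
  have hnn : ∀ i, 0 ≤ᵐ[μ] fun ω => |ξ i ω| ^ 3 * Real.exp (x * |ξ i ω|) := fun i =>
    ae_of_all _ fun ω => by positivity
  have hmeas : ∀ i, AEStronglyMeasurable (fun ω => |ξ i ω| ^ 3 * Real.exp (x * |ξ i ω|)) μ :=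
    fun i => by
      have := hm i
      exact Measurable.aestronglyMeasurable (by fun_prop)
  have h3 : ∀ i, Integrable (fun ω => |ξ i ω| ^ 3 * Real.exp (x * |ξ i ω|)) μ := fun i =>
    (lintegral_ofReal_ne_top_iff_integrable (hmeas i) (hnn i)).1 (hfi i).ne
  have hexp' : ∀ i, Integrable (fun ω => Real.exp (x * |ξ i ω|)) μ := fun i => by
    have := hm i
    refine (hexp i).mono' (by fun_prop) (ae_of_all _ fun ω => ?_)
    rw [Real.norm_eq_abs, abs_of_pos (Real.exp_pos _)]
    gcongr
  refine abs_measureReal_div_sub_one_le hm hind hx hexp' h3 h0 h1 ?_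
  rw [cramerGamma, ENNReal.toReal_sum fun i _ => (hfi i).ne]
  exact Finset.sum_congr rfl fun i _ =>
    (integral_eq_lintegral_of_nonneg_ae (hnn i) (hmeas i)).symm
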